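/- Let $d\ge 1$, let $\Omega\subset\mathbb R^d$ be open, and let $\Lambda\subset\mathbb R^d$ be a bounded open set with $\Omega\subset\Lambda$. Let $u,v\in H^1_0(\Lambda)$ be real-valued, extended by zero to $\mathbb R^d$. For $s\in(0,1/2)$ and $\rho\in\mathbb R$ put $$G_s(\rho)=\int_0^\rho(1+r^2)^{-(d+1+2s)/2}\,dr,\qquad d_w(x,y)=\frac{w(x)-w(y)}{|x-y|},\qquad C_{d,s}=\frac{1-2s}{\alpha_d},$$ where $\alpha_d$ is the volume of the unit ball of $\mathbb R^d$, let $Q_\Omega=(\mathbb R^d\times\mathbb R^d)\setminus(\Omega^c\times\Omega^c)$ with $\Omega^c=\mathbb R^d\setminus\Omega$, and define the nonlocal geometric error $$e_s(u,v)=\Big(C_{d,s}\iint_{Q_\Omega}\big(G_s(d_u(x,y))-G_s(d_v(x,y))\big)\,\frac{d_{u-v}(x,y)}{|x-y|^{d-1+2s}}\,dx\,dy\Big)^{1/2}.$$ Let also $Q(a)=\sqrt{1+|a|^2}$ and $\widehat\nu(a)=\dfrac{(a,-1)}{Q(a)}\in\mathbb R^{d+1}$ for $a\in\mathbb R^d$,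 and $$e(u,v)=\Big(\int_\Omega\big|\widehat\nu(\nabla u)-\widehat\nu(\nabla v)\big|^2\,\frac{Q(\nabla u)+Q(\nabla v)}{2}\,dx\Big)^{1/2},$$ with $\nabla u,\nabla v$ the weak gradients. Then the integrals defining $e_s(u,v)$ (for every $s\in(0,1/2)$) and $e(u,v)$ converge absolutely, and $$\lim_{s\to\frac12^-}e_s(u,v)=e(u,v).$$ -/

import Mathlib

open MeasureTheory Filter Topology Set
open scoped ContDiff Gradient

noncomputable section

namespace NonlocalGraph

/-- The space `ℝ^d` with its Euclidean norm. -/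
abbrev Euc (d : ℕ) : Type := EuclideanSpace ℝ (Fin d)

/-- `φ ∈ C_c^∞(U)`, as a function on all of `ℝ^d` that vanishes outside `U`. -/
def IsTestFunction {d : ℕ} (U : Set (Euc d)) (φ : Euc d → ℝ) : Prop :=
  ContDiff ℝ ∞ φ ∧ HasCompactSupport φ ∧ tsupport φ ⊆ U

/-- `g` is the weak (distributional) gradient of `u` on the open set `U`. -/
def HasWeakGradientOn {d : ℕ} (U : Set (Euc d)) (u : Euc d → ℝ) (g : Euc d → Euc d) : Prop :=
  LocallyIntegrableOn u U ∧ LocallyIntegrableOn g U ∧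
    ∀ φ : Euc d → ℝ, IsTestFunction U φ → ∫ x in U, u x • ∇ φ x = -∫ x in U, φ x • g x

open Classical in
/-- The weak gradient of `u` on the open set `U`; it is determined up to a null set when it exists,
and is set to be zero when it does not exist. -/
def weakGradient {d : ℕ} (U : Set (Euc d)) (u : Euc d → ℝ) : Euc d → Euc d :=
  if h : ∃ g, HasWeakGradientOn U u g then h.choose else 0

/-- `u ∈ H^1_0(Λ)`, as a function on all of `ℝ^d` extended by zero outside `Λ`: the closure of
`C_c^∞(Λ)` in `H^1(Λ)`. -/
def MemH10 {d : ℕ} (Λ : Set (Euc d)) (u : Euc d → ℝ) : Prop :=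
  (∀ᵐ x, x ∉ Λ → u x = 0) ∧ MemLp u 2 (volume.restrict Λ) ∧
  ∃ g : Euc d → Euc d, HasWeakGradientOn Λ u g ∧ MemLp g 2 (volume.restrict Λ) ∧
    ∃ φ : ℕ → Euc d → ℝ, (∀ n, IsTestFunction Λ (φ n)) ∧
      Tendsto (fun n => eLpNorm (fun x => u x - φ n x) 2 (volume.restrict Λ)) atTop (𝓝 0) ∧
      Tendsto (fun n => eLpNorm (fun x => g x - ∇ (φ n) x) 2 (volume.restrict Λ)) atTop (𝓝 0)

/-- The area element `Q(a) = √(1 + |a|²)`. -/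
def areaElement {d : ℕ} (a : Euc d) : ℝ := Real.sqrt (1 + ‖a‖ ^ 2)

/-- The unit normal `(a, -1) / Q(a) ∈ ℝ^d × ℝ = ℝ^{d+1}` (Euclidean norm on the product). -/
def unitNormal {d : ℕ} (a : Euc d) : WithLp 2 (Euc d × ℝ) :=
  (areaElement a)⁻¹ • WithLp.toLp 2 (a, (-1 : ℝ))

/-- The integrand of `e(u,v)²`. -/
def localErrorIntegrand {d : ℕ} (Ω : Set (Euc d)) (u v : Euc d → ℝ) (x : Euc d) : ℝ :=
  ‖unitNormal (weakGradient Ω u x) - unitNormal (weakGradient Ω v x)‖ ^ 2 *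
    ((areaElement (weakGradient Ω u x) + areaElement (weakGradient Ω v x)) / 2)

/-- The classical geometric error `e(u,v)` on `Ω`. -/
def localError {d : ℕ} (Ω : Set (Euc d)) (u v : Euc d → ℝ) : ℝ :=
  Real.sqrt (∫ x in Ω, localErrorIntegrand Ω u v x)

/-- `G_s(ρ) = ∫_0^ρ (1 + r²)^{-(d+1+2s)/2} dr`. -/
def G (d : ℕ) (s ρ : ℝ) : ℝ :=
  ∫ r in (0 : ℝ)..ρ, (1 + r ^ 2) ^ (-((d : ℝ) + 1 + 2 * s) / 2)

/-- The difference quotient `d_v(x,y) = (v(x) - v(y)) / |x - y|`. -/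
def diffQuot {d : ℕ} (v : Euc d → ℝ) (x y : Euc d) : ℝ := (v x - v y) / ‖x - y‖

/-- `C_{d,s} = (1 - 2s) / α_d`, where `α_d` is the volume of the unit ball of `ℝ^d`. -/
def scaling (d : ℕ) (s : ℝ) : ℝ := (1 - 2 * s) / volume.real (Metric.ball (0 : Euc d) 1)

/-- `Q_Ω = (ℝ^d × ℝ^d) \ (Ω^c × Ω^c)`. -/
def interactionSet {d : ℕ} (Ω : Set (Euc d)) : Set (Euc d × Euc d) := (Ωᶜ ×ˢ Ωᶜ)ᶜ

/-- The integrand of `e_s(u,v)²`, without the factor `C_{d,s}`. -/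
def nonlocalErrorIntegrand {d : ℕ} (s : ℝ) (u v : Euc d → ℝ) (p : Euc d × Euc d) : ℝ :=
  (G d s (diffQuot u p.1 p.2) - G d s (diffQuot v p.1 p.2)) *
    (diffQuot (u - v) p.1 p.2 / ‖p.1 - p.2‖ ^ ((d : ℝ) - 1 + 2 * s))

/-- The nonlocal geometric error `e_s(u,v)` on `Ω`. -/
def nonlocalError {d : ℕ} (s : ℝ) (Ω : Set (Euc d)) (u v : Euc d → ℝ) : ℝ :=
  Real.sqrt (scaling d s * ∫ p in interactionSet Ω, nonlocalErrorIntegrand s u v p)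

end NonlocalGraph

end

/-! Put `F_s(p, q) = (G_s(p) - G_s(q)) (p - q)` (`monoForm`). With `y = x + h`, the normalized
nonlocal integrand is `κ_s(h) F_s(p, q)`, where `p`, `q` are the difference quotients of `u`, `v`
with increment `h` and `κ_s(h) = C_{d,s} |h|^{-(d-1+2s)}`. This kernel has mass `d` on the unit ball
for every `s < 1/2`, while its factor `1 - 2s` makes it vanish uniformly on `δ ≤ |h| < 1` as `s →
1/2`. At infinity `κ_s` is not integrable, but there the squared `L²` norms of the quotients decay
like `|h|^{-2}`. Hence only infinitesimal increments survive in the limit.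

For small `h` the quotients of an `H¹` function are close in `L²` to the derivatives along `h/|h|`,
uniformly in the direction (`HasStrongGradient.tendsto_incQuot`); `G_s` is close to `G_{1/2}` with
an explicit rate (`abs_monoForm_sub_half_le`); and a point of the open set `Ω` stays in `Ω` under
small translations, so the doubled weight of pairs crossing the boundary disappears
(`tendsto_exitEnergy`). What remains is the spherical average of `F_{1/2}(∇u·θ, ∇v·θ)`.

This average is explicit. A Gaussian integral, evaluated in Cartesian and in polar coordinates,
yields the spherical integral of the kernel of `G_{1/2}`, because the radial integral produces
exactly the power `-(d+2)/2`. Integrating in a parameter gives `a·c / Q(a)` as the average of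
`G_{1/2}(a·θ) (c·θ)` (`integral_ball_kappa_mul_G`), and an algebraic identity for unit normals
(`norm_unitNormal_sub_sq_mul`) turns this into the local integrand.
`abs_integral_kappa_mul_shiftForm_sub_le` assembles the estimates. -/

noncomputable section
namespace NonlocalGraph

/-! ### The function `G_s` and its monotone form -/

/-- The integrand `(1 + r²)^{-(d+1+2s)/2}` of `G_s`. -/
def gKernel (d : ℕ) (s r : ℝ) : ℝ := (1 + r ^ 2) ^ (-((d : ℝ) + 1 + 2 * s) / 2)

lemma continuous_gKernel (d : ℕ) (s : ℝ) : Continuous (gKernel d s) := by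
  unfold gKernel
  refine Continuous.rpow_const (by fun_prop) fun x => Or.inl (by positivity)

lemma gKernel_nonneg (d : ℕ) (s r : ℝ) : 0 ≤ gKernel d s r := by
  unfold gKernel; positivity

lemma gKernel_le_one {d : ℕ} {s : ℝ} (hs : 0 ≤ s) (r : ℝ) : gKernel d s r ≤ 1 := by
  unfold gKernel
  refine Real.rpow_le_one_of_one_le_of_nonpos (by nlinarith [sq_nonneg r]) ?_
  have : (0 : ℝ) ≤ d := by positivity
  linarith

lemma gKernel_neg (d : ℕ) (s r : ℝ) : gKernel d s (-r) = gKernel d s r := by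
  simp [gKernel]

lemma G_eq (d : ℕ) (s ρ : ℝ) : G d s ρ = ∫ r in (0 : ℝ)..ρ, gKernel d s r := rfl

lemma G_zero (d : ℕ) (s : ℝ) : G d s 0 = 0 := by simp [G]

lemma G_neg (d : ℕ) (s ρ : ℝ) : G d s (-ρ) = -G d s ρ := by
  have h := intervalIntegral.integral_comp_neg (a := 0) (b := ρ) (gKernel d s)
  simp only [gKernel_neg, neg_zero] at h
  rw [G_eq, G_eq, h, intervalIntegral.integral_symm]

lemma G_sub (d : ℕ) (s a b : ℝ) : G d s a - G d s b = ∫ r in b..a, gKernel d s r := by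
  rw [G_eq, G_eq, intervalIntegral.integral_interval_sub_left] <;>
  exact (continuous_gKernel d s).intervalIntegrable _ _

lemma abs_G_sub_le {d : ℕ} {s : ℝ} (hs : 0 ≤ s) (a b : ℝ) :
    |G d s a - G d s b| ≤ |a - b| := by
  rw [G_sub]
  have := intervalIntegral.norm_integral_le_of_norm_le_const (a := b) (b := a) (C := 1)
    (f := gKernel d s) fun x _ => by
      rw [Real.norm_of_nonneg (gKernel_nonneg d s x)]; exact gKernel_le_one hs x
  simpa using this

lemma G_monotone (d : ℕ) (s : ℝ) : Monotone (G d s) := fun a b hab => by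
  rw [← sub_nonneg, G_sub]
  exact intervalIntegral.integral_nonneg hab fun x _ => gKernel_nonneg d s x

lemma continuous_G {d : ℕ} {s : ℝ} (hs : 0 ≤ s) : Continuous (G d s) :=
  (LipschitzWith.of_dist_le_mul (K := 1) fun a b => by
    simpa [Real.dist_eq] using abs_G_sub_le hs a b).continuous

/-- With `y = 1 + r²`, the two kernels differ by the factor `y^((1-2s)/2)`. Bernoulli's inequality
bounds its excess over 1 by `(1-2s)/2 * y`, and the growth in `y` is absorbed because the kernel at
`1/2` decays at least like `1/y`. -/
lemma abs_gKernel_sub_le {d : ℕ} {s : ℝ} (hs : 0 ≤ s) (hs' : s ≤ 1 / 2) (r : ℝ) :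
    |gKernel d s r - gKernel d (1 / 2) r| ≤ (1 - 2 * s) / 2 := by
  set y : ℝ := 1 + r ^ 2 with hy
  have hy1 : 1 ≤ y := by nlinarith [sq_nonneg r]
  have hy0 : 0 < y := by linarith
  have hfac : gKernel d s r = gKernel d (1 / 2) r * y ^ ((1 - 2 * s) / 2) := by
    unfold gKernel
    rw [← hy, ← Real.rpow_add hy0]
    congr 1
    ring
  have hB : y ^ ((1 - 2 * s) / 2) ≤ 1 + (1 - 2 * s) / 2 * (y - 1) := by
    have := _root_.rpow_one_add_le_one_add_mul_self (s := y - 1) (by linarith)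
      (p := (1 - 2 * s) / 2) (by linarith) (by linarith)
    simpa using this
  have hB' : 1 ≤ y ^ ((1 - 2 * s) / 2) := Real.one_le_rpow hy1 (by linarith)
  have hg : gKernel d (1 / 2) r * y ≤ 1 := by
    unfold gKernel
    rw [← hy]
    nth_rewrite 2 [← Real.rpow_one y]
    rw [← Real.rpow_add hy0]
    refine Real.rpow_le_one_of_one_le_of_nonpos hy1 ?_
    have : (0 : ℝ) ≤ d := by positivity
    linarith
  have hg0 := gKernel_nonneg d (1 / 2) r
  rw [hfac, abs_of_nonneg (by nlinarith)]
  have h1 : gKernel d (1 / 2) r * (y ^ ((1 - 2 * s) / 2) - 1)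
      ≤ gKernel d (1 / 2) r * ((1 - 2 * s) / 2 * y) := by
    refine mul_le_mul_of_nonneg_left ?_ hg0
    nlinarith
  nlinarith

lemma abs_G_sub_G_half_le {d : ℕ} {s : ℝ} (hs : 0 ≤ s) (hs' : s ≤ 1 / 2) (ρ : ℝ) :
    |G d s ρ - G d (1 / 2) ρ| ≤ (1 - 2 * s) / 2 * |ρ| := by
  rw [G_eq, G_eq, ← intervalIntegral.integral_sub
    ((continuous_gKernel d s).intervalIntegrable _ _)
    ((continuous_gKernel d _).intervalIntegrable _ _)]
  have := intervalIntegral.norm_integral_le_of_norm_le_const (a := 0) (b := ρ)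
    (C := (1 - 2 * s) / 2)
    (f := fun r => gKernel d s r - gKernel d (1 / 2) r) fun x _ => abs_gKernel_sub_le hs hs' x
  simpa using this

/-- The monotone form `(G_s(a) - G_s(b)) (a - b)`. -/
def monoForm (d : ℕ) (s a b : ℝ) : ℝ := (G d s a - G d s b) * (a - b)

lemma monoForm_nonneg (d : ℕ) (s a b : ℝ) : 0 ≤ monoForm d s a b := by
  unfold monoForm
  rcases le_total a b with h | h
  · exact mul_nonneg_of_nonpos_of_nonpos (sub_nonpos.2 (G_monotone d s h)) (sub_nonpos.2 h)
  · exact mul_nonneg (sub_nonneg.2 (G_monotone d s h)) (sub_nonneg.2 h)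

lemma monoForm_le {d : ℕ} {s : ℝ} (hs : 0 ≤ s) (a b : ℝ) : monoForm d s a b ≤ (a - b) ^ 2 := by
  refine (le_abs_self _).trans ?_
  rw [monoForm, abs_mul, ← sq_abs (a - b), sq]
  exact mul_le_mul_of_nonneg_right (abs_G_sub_le hs a b) (abs_nonneg _)

lemma monoForm_neg (d : ℕ) (s a b : ℝ) : monoForm d s (-a) (-b) = monoForm d s a b := by
  simp only [monoForm, G_neg]; ring

lemma continuous_monoForm {d : ℕ} {s : ℝ} (hs : 0 ≤ s) :
    Continuous fun p : ℝ × ℝ => monoForm d s p.1 p.2 := by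
  unfold monoForm
  have := continuous_G (d := d) hs
  fun_prop

/-- The error is quadratic in the arguments, so inserting `L²` difference quotients gives a bound by
gradient norms that does not depend on the increment. -/
lemma abs_monoForm_sub_half_le {d : ℕ} {s : ℝ} (hs : 0 ≤ s) (hs' : s ≤ 1 / 2) (a b : ℝ) :
    |monoForm d s a b - monoForm d (1 / 2) a b| ≤ (1 - 2 * s) * (a ^ 2 + b ^ 2) := by
  have h1 := abs_G_sub_G_half_le (d := d) hs hs' a
  have h2 := abs_G_sub_G_half_le (d := d) hs hs' b
  have : monoForm d s a b - monoForm d (1 / 2) a b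
      = ((G d s a - G d (1 / 2) a) - (G d s b - G d (1 / 2) b)) * (a - b) := by
    unfold monoForm; ring
  rw [this, abs_mul]
  have h3 : |(G d s a - G d (1 / 2) a) - (G d s b - G d (1 / 2) b)|
      ≤ (1 - 2 * s) / 2 * (|a| + |b|) := by
    refine (abs_sub _ _).trans ?_
    linarith
  calc _ ≤ ((1 - 2 * s) / 2 * (|a| + |b|)) * (|a| + |b|) :=
        mul_le_mul h3 (abs_sub _ _) (abs_nonneg _) (mul_nonneg (by linarith) (by positivity))
    _ ≤ _ := by
        have e : (|a| + |b|) * (|a| + |b|) ≤ 2 * (a ^ 2 + b ^ 2) := by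
          nlinarith [sq_nonneg (|a| - |b|), sq_abs a, sq_abs b]
        nlinarith

/-- Telescoping the product, with `G_s` 1-Lipschitz. Each term is a product of a small `L²` factor
and a bounded `L²` factor, ready for Cauchy–Schwarz. -/
lemma abs_monoForm_sub_le {d : ℕ} {s : ℝ} (hs : 0 ≤ s) (a b a' b' : ℝ) :
    |monoForm d s a b - monoForm d s a' b'|
      ≤ (|a - a'| + |b - b'|) * (|a - b| + |a' - b'|) := by
  have : monoForm d s a b - monoForm d s a' b'
      = ((G d s a - G d s a') - (G d s b - G d s b')) * (a - b)
        + (G d s a' - G d s b') * ((a - a') - (b - b')) := by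
    unfold monoForm; ring
  rw [this]
  refine (abs_add_le _ _).trans ?_
  rw [abs_mul, abs_mul, mul_add]
  have h1 : |(G d s a - G d s a') - (G d s b - G d s b')| ≤ |a - a'| + |b - b'| :=
    (abs_sub _ _).trans (add_le_add (abs_G_sub_le hs _ _) (abs_G_sub_le hs _ _))
  have h2 : |(a - a') - (b - b')| ≤ |a - a'| + |b - b'| := abs_sub _ _
  have h3 := abs_G_sub_le (d := d) hs a' b'
  refine add_le_add (mul_le_mul_of_nonneg_right h1 (abs_nonneg _)) ?_
  rw [mul_comm]
  exact mul_le_mul h2 h3 (abs_nonneg _) (by positivity)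

/-! ### The local geometric form as an algebraic expression -/

lemma one_le_areaElement {d : ℕ} (a : Euc d) : 1 ≤ areaElement a := by
  rw [areaElement, Real.one_le_sqrt]
  nlinarith [sq_nonneg ‖a‖]

lemma areaElement_sq {d : ℕ} (a : Euc d) : areaElement a ^ 2 = 1 + ‖a‖ ^ 2 :=
  Real.sq_sqrt (by positivity)

/-- The right-hand side is the monotone form of the minimal surface operator. After `|a|² = Q(a)² -
1` and `|b|² = Q(b)² - 1` both sides are rational in `Q(a)`, `Q(b)` and `a·b`. -/
lemma norm_unitNormal_sub_sq_mul {d : ℕ} (a b : Euc d) :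
    ‖unitNormal a - unitNormal b‖ ^ 2 * ((areaElement a + areaElement b) / 2)
      = inner ℝ a (a - b) / areaElement a - inner ℝ b (a - b) / areaElement b := by
  have ha := areaElement_sq a
  have hb := areaElement_sq b
  have ha1 := one_le_areaElement a
  have hb1 := one_le_areaElement b
  set p := areaElement a with hp
  set q := areaElement b with hq
  have hp0 : p ≠ 0 := by linarith
  have hq0 : q ≠ 0 := by linarith
  have key : ‖unitNormal a - unitNormal b‖ ^ 2 = ‖p⁻¹ • a - q⁻¹ • b‖ ^ 2 + (p⁻¹ - q⁻¹) ^ 2 := by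
    rw [WithLp.prod_norm_sq_eq_of_L2]
    simp only [unitNormal, ← hp, ← hq]
    congr 1
    simp
    ring
  rw [key, norm_sub_sq_real, norm_smul, norm_smul, inner_smul_left, inner_smul_right,
    inner_sub_right, inner_sub_right, real_inner_self_eq_norm_sq, real_inner_self_eq_norm_sq,
    real_inner_comm a b, mul_pow, mul_pow]
  have ha2 : ‖a‖ ^ 2 = p ^ 2 - 1 := by linarith
  have hb2 : ‖b‖ ^ 2 = q ^ 2 - 1 := by linarith
  rw [ha2, hb2]
  simp only [norm_inv, Real.norm_eq_abs, inv_pow, sq_abs, conj_trivial]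
  field_simp
  ring

/-! ### Polar coordinates for nonnegative integrands -/

section Polar

variable {E : Type*} [NormedAddCommGroup E] [NormedSpace ℝ E] [MeasurableSpace E] [BorelSpace E]
  [FiniteDimensional ℝ E] [Nontrivial E]

open Metric in
/-- Integration in polar coordinates. -/
lemma lintegral_polar (μ : Measure E) [μ.IsAddHaarMeasure] {f : E → ENNReal} (hf : Measurable f) :
    ∫⁻ x, f x ∂μ = ∫⁻ θ : sphere (0 : E) 1, (∫⁻ r in Ioi (0 : ℝ),
      ENNReal.ofReal (r ^ (Module.finrank ℝ E - 1)) * f (r • (θ : E))) ∂μ.toSphere := by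
  have hm : Measurable fun p : sphere (0 : E) 1 × Ioi (0 : ℝ) => f ((p.2 : ℝ) • (p.1 : E)) := by
    fun_prop
  calc
    ∫⁻ x, f x ∂μ = ∫⁻ x : ({(0)}ᶜ : Set E), f x ∂(μ.comap (↑)) := by
      rw [lintegral_subtype_comap (measurableSet_singleton _).compl, restrict_compl_singleton]
    _ = ∫⁻ p, f ((p.2 : ℝ) • (p.1 : E))
          ∂μ.toSphere.prod (.volumeIoiPow (Module.finrank ℝ E - 1)) := by
      rw [← μ.measurePreserving_homeomorphUnitSphereProd.lintegral_comp hm]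
      refine lintegral_congr fun x => ?_
      have := congrArg Subtype.val ((homeomorphUnitSphereProd E).symm_apply_apply x)
      rw [homeomorphUnitSphereProd_symm_apply_coe] at this
      rw [this]
    _ = _ := by
      rw [lintegral_prod _ hm.aemeasurable]
      refine lintegral_congr fun θ => ?_
      rw [Measure.volumeIoiPow, lintegral_withDensity_eq_lintegral_mul _
        (f := fun r : Ioi (0 : ℝ) => ENNReal.ofReal ((r : ℝ) ^ (Module.finrank ℝ E - 1)))
        (by fun_prop) (by fun_prop)]
      simp only [Pi.mul_apply]
      rw [lintegral_subtype_comap measurableSet_Ioi fun r : ℝ =>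
        ENNReal.ofReal (r ^ (Module.finrank ℝ E - 1)) * f (r • (θ : E))]

open Metric in
lemma lintegral_radial_mul_direction (μ : Measure E) [μ.IsAddHaarMeasure] {p : ℝ → ENNReal}
    {k : E → ENNReal} (hp : Measurable p) (hk : Measurable k) :
    ∫⁻ x, p ‖x‖ * k (‖x‖⁻¹ • x) ∂μ = (∫⁻ θ : sphere (0 : E) 1, k θ ∂μ.toSphere) *
      ∫⁻ r in Ioi (0 : ℝ), ENNReal.ofReal (r ^ (Module.finrank ℝ E - 1)) * p r := by
  rw [lintegral_polar μ (by fun_prop), ← lintegral_mul_const'' _ (by fun_prop)]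
  refine lintegral_congr fun θ => ?_
  rw [← lintegral_const_mul'' _ (by fun_prop)]
  refine setLIntegral_congr_fun measurableSet_Ioi fun r hr => ?_
  have hr : 0 < r := hr
  have hθ : ‖(θ : E)‖ = 1 := by simp
  have h1 : ‖r • (θ : E)‖ = r := by rw [norm_smul, hθ, Real.norm_of_nonneg hr.le, mul_one]
  simp only [h1, smul_smul, inv_mul_cancel₀ hr.ne', one_smul]
  ring

end Polar

/-! ### The Gaussian integral and the spherical integral of the kernel -/

lemma integral_sq_mul_exp_neg_mul_sq {b : ℝ} (hb : 0 < b) :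
    ∫ y : ℝ, y ^ 2 * Real.exp (-b * y ^ 2) = b ^ (-(3 : ℝ) / 2) * (√Real.pi / 2) := by
  have h := integral_comp_abs (f := fun y => y ^ 2 * Real.exp (-b * y ^ 2))
  simp only [sq_abs] at h
  rw [h]
  have h2 := integral_rpow_mul_exp_neg_mul_rpow (p := 2) (q := 2) (b := b) (by norm_num)
    (by norm_num) hb
  simp only [Real.rpow_two] at h2
  rw [h2]
  have h3 : Real.Gamma ((2 + 1) / 2) = √Real.pi / 2 := by
    rw [show ((2 : ℝ) + 1) / 2 = 1 / 2 + 1 by norm_num, Real.Gamma_add_one (by norm_num),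
      Real.Gamma_one_half_eq]
    ring
  rw [h3]
  norm_num
  ring

/-- The Gaussian integral behind the spherical averages of `G_{1/2}`. -/
lemma integral_gaussian_mul_inner_sq {d : ℕ} (hd : 1 ≤ d) {e : Euc d} (he : ‖e‖ = 1) (t : ℝ) :
    ∫ x : Euc d, Real.exp (-‖x‖ ^ 2 - t ^ 2 * inner ℝ e x ^ 2) * inner ℝ e x ^ 2
      = √Real.pi ^ d / 2 * (1 + t ^ 2) ^ (-(3 : ℝ) / 2) := by
  obtain ⟨n, rfl⟩ : ∃ n, d = n + 1 := ⟨d - 1, by omega⟩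
  obtain ⟨b, hb⟩ := Orthonormal.exists_orthonormalBasis_extension_of_card_eq (𝕜 := ℝ)
    (ι := Fin (n + 1)) (E := Euc (n + 1)) (by simp) (v := fun _ => e) (s := {0})
    (by
      rw [orthonormal_iff_ite]
      rintro ⟨i, hi⟩ ⟨j, hj⟩
      simp only [mem_singleton_iff] at hi hj
      subst hi; subst hj
      simp [he])
  have hb0 : b 0 = e := hb 0 rfl
  -- In an orthonormal basis whose first vector is `e`, the integrand is a product of one-variable
  -- functions; only the first factor involves `t`.
  set f : Fin (n + 1) → ℝ → ℝ := Fin.cons (fun y => y ^ 2 * Real.exp (-(1 + t ^ 2) * y ^ 2))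
    (fun _ y => Real.exp (-1 * y ^ 2)) with hf
  have h1 : ∀ x : Euc (n + 1), Real.exp (-‖x‖ ^ 2 - t ^ 2 * inner ℝ e x ^ 2) * inner ℝ e x ^ 2
      = (fun z : Fin (n + 1) → ℝ => ∏ i, f i (z i)) (WithLp.ofLp (b.repr x)) := by
    intro x
    have hx : inner ℝ e x = b.repr x 0 := by rw [b.repr_apply_apply, hb0]
    have hn : ‖x‖ ^ 2 = b.repr x 0 ^ 2 + ∑ i : Fin n, b.repr x i.succ ^ 2 := by
      rw [← b.repr.norm_map x, EuclideanSpace.norm_sq_eq, Fin.sum_univ_succ]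
      simp
    simp only [hf, Fin.prod_univ_succ, Fin.cons_zero, Fin.cons_succ]
    rw [hx, hn, ← Real.exp_sum, ← Finset.mul_sum, mul_assoc, ← Real.exp_add, mul_comm]
    congr 2
    ring
  rw [integral_congr_ae (Eventually.of_forall h1)]
  rw [((b.measurePreserving_repr)).integral_comp
    (b.repr.toHomeomorph.measurableEmbedding)
    (fun y : Euc (n + 1) => (fun z : Fin (n + 1) → ℝ => ∏ i, f i (z i)) (WithLp.ofLp y))]
  rw [(PiLp.volume_preserving_ofLp (Fin (n + 1))).integral_comp
    (MeasurableEquiv.toLp 2 (Fin (n + 1) → ℝ)).symm.measurableEmbedding (fun z : Fin (n + 1) → ℝ => ∏ i, f i (z i))]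
  rw [integral_fintype_prod_volume_eq_prod, Fin.prod_univ_succ]
  simp only [hf, Fin.cons_zero, Fin.cons_succ, integral_gaussian, Finset.prod_const,
    Finset.card_univ, Fintype.card_fin, div_one]
  rw [integral_sq_mul_exp_neg_mul_sq (by positivity)]
  ring

lemma ballVolume_eq {d : ℕ} (hd : 1 ≤ d) : volume.real (Metric.ball (0 : Euc d) 1)
    = √Real.pi ^ d / Real.Gamma (d / 2 + 1) := by
  have : Nonempty (Fin d) := ⟨⟨0, hd⟩⟩
  rw [Measure.real, EuclideanSpace.volume_ball]
  simp only [ENNReal.ofReal_one, one_pow, one_mul, Fintype.card_fin]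
  rw [ENNReal.toReal_ofReal]
  have := Real.Gamma_pos_of_pos (s := (d : ℝ) / 2 + 1) (by positivity)
  positivity

lemma ballVolume_pos (d : ℕ) : 0 < volume.real (Metric.ball (0 : Euc d) 1) := by
  rw [Measure.real, ENNReal.toReal_pos_iff]
  exact ⟨Metric.measure_ball_pos _ _ one_pos, measure_ball_lt_top⟩

/-- The exponent collects to `-(1 + (tc)²) r²` against `r^(d+1)`. The Gamma integral then produces
`(1 + (tc)²)^(-(d+2)/2)`, which is the kernel of `G_{1/2}` at `tc`; this is why the value `1/2` is
special. -/
lemma lintegral_radial_gaussian {d : ℕ} (hd : 1 ≤ d) (t c : ℝ) :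
    ∫⁻ r in Ioi (0 : ℝ), ENNReal.ofReal (r ^ (d - 1)) *
        ENNReal.ofReal (Real.exp (-r ^ 2 - t ^ 2 * (r * c) ^ 2) * (r * c) ^ 2)
      = ENNReal.ofReal (gKernel d (1 / 2) (t * c) * c ^ 2) *
        ENNReal.ofReal (Real.Gamma (d / 2 + 1) / 2) := by
  have hb : 0 < 1 + (t * c) ^ 2 := by positivity
  have hG := Real.Gamma_pos_of_pos (s := (d : ℝ) / 2 + 1) (by positivity)
  have h := integral_rpow_mul_exp_neg_mul_rpow (p := 2) (q := d + 1) (b := 1 + (t * c) ^ 2)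
    (by norm_num) (by linarith [(Nat.cast_nonneg d : (0 : ℝ) ≤ d)]) hb
  rw [show ((d : ℝ) + 1 + 1) / 2 = d / 2 + 1 by ring] at h
  have hpos : 0 < (1 + (t * c) ^ 2) ^ (-((d : ℝ) + 1 + 1) / 2) * (1 / 2)
      * Real.Gamma (d / 2 + 1) := by positivity
  have hint : IntegrableOn (fun x : ℝ => x ^ ((d : ℝ) + 1) *
      Real.exp (-(1 + (t * c) ^ 2) * x ^ (2 : ℝ))) (Ioi 0) := by
    -- A nonintegrable function has integral 0 by convention, so the positive value in `h` forces
    -- integrability.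
    by_contra hcon
    rw [integral_undef hcon] at h
    exact hpos.ne h
  have h2 : ∀ r ∈ Ioi (0 : ℝ), ENNReal.ofReal (r ^ (d - 1)) *
        ENNReal.ofReal (Real.exp (-r ^ 2 - t ^ 2 * (r * c) ^ 2) * (r * c) ^ 2)
      = ENNReal.ofReal (c ^ 2) * ENNReal.ofReal (r ^ ((d : ℝ) + 1) *
        Real.exp (-(1 + (t * c) ^ 2) * r ^ (2 : ℝ))) := by
    intro r hr
    have hr : 0 < r := hr
    rw [← ENNReal.ofReal_mul (by positivity), ← ENNReal.ofReal_mul (by positivity)]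
    congr 1
    rw [show (d : ℝ) + 1 = ((d + 1 : ℕ) : ℝ) by push_cast; ring, Real.rpow_natCast, Real.rpow_two,
      show d + 1 = (d - 1) + 2 by omega, pow_add,
      show -r ^ 2 - t ^ 2 * (r * c) ^ 2 = -(1 + (t * c) ^ 2) * r ^ 2 by ring]
    ring
  rw [setLIntegral_congr_fun measurableSet_Ioi h2, lintegral_const_mul _ (by fun_prop),
    ← ofReal_integral_eq_lintegral_ofReal hint
      ((ae_restrict_mem measurableSet_Ioi).mono fun r hr => by
        have : 0 < r := hr
        positivity), h, ← ENNReal.ofReal_mul (by positivity), ← ENNReal.ofReal_mul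
        (mul_nonneg (gKernel_nonneg _ _ _) (sq_nonneg _))]
  congr 1
  unfold gKernel
  rw [show -((d : ℝ) + 1 + 2 * (1 / 2)) / 2 = -((d : ℝ) + 1 + 1) / 2 by ring]
  ring

-- The Gaussian integral, known in closed form, is rewritten in polar coordinates. Its radial part
-- is `Γ(d/2+1)/2` times the integrand here, and dividing by that constant leaves the ball volume
-- `π^(d/2) / Γ(d/2+1)`.
open Metric in
lemma lintegral_sphere_gKernel {d : ℕ} (hd : 1 ≤ d) {e : Euc d} (he : ‖e‖ = 1) (t : ℝ) :
    ∫⁻ θ : sphere (0 : Euc d) 1, ENNReal.ofReal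
        (gKernel d (1 / 2) (t * inner ℝ e (θ : Euc d)) * inner ℝ e (θ : Euc d) ^ 2)
        ∂(volume : Measure (Euc d)).toSphere
      = ENNReal.ofReal (volume.real (ball (0 : Euc d) 1) * (1 + t ^ 2) ^ (-(3 : ℝ) / 2)) := by
  have : Nonempty (Fin d) := ⟨⟨0, hd⟩⟩
  have hG := Real.Gamma_pos_of_pos (s := (d : ℝ) / 2 + 1) (by positivity)
  have hk := continuous_gKernel d (1 / 2)
  have h := integral_gaussian_mul_inner_sq hd he t
  have hpos : 0 < √Real.pi ^ d / 2 * (1 + t ^ 2) ^ (-(3 : ℝ) / 2) := by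
    have := Real.pi_pos
    positivity
  have hint : Integrable fun x : Euc d =>
      Real.exp (-‖x‖ ^ 2 - t ^ 2 * inner ℝ e x ^ 2) * inner ℝ e x ^ 2 := by
    by_contra hcon
    rw [integral_undef hcon] at h
    exact hpos.ne h
  have h2 := ofReal_integral_eq_lintegral_ofReal hint
    (Eventually.of_forall fun x => by positivity)
  rw [h, lintegral_polar volume (by fun_prop)] at h2
  have h3 : ∀ θ : sphere (0 : Euc d) 1, ∫⁻ r in Ioi (0 : ℝ),
      ENNReal.ofReal (r ^ (Module.finrank ℝ (Euc d) - 1)) * ENNReal.ofReal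
        (Real.exp (-‖r • (θ : Euc d)‖ ^ 2 - t ^ 2 * inner ℝ e (r • (θ : Euc d)) ^ 2)
          * inner ℝ e (r • (θ : Euc d)) ^ 2)
      = ENNReal.ofReal (gKernel d (1 / 2) (t * inner ℝ e (θ : Euc d)) * inner ℝ e (θ : Euc d) ^ 2)
        * ENNReal.ofReal (Real.Gamma (d / 2 + 1) / 2) := by
    intro θ
    rw [← lintegral_radial_gaussian hd]
    have hθ : ‖(θ : Euc d)‖ = 1 := by simp
    simp only [finrank_euclideanSpace, Fintype.card_fin, norm_smul, hθ, inner_smul_right, mul_one,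
      Real.norm_eq_abs, sq_abs]
  simp only [h3] at h2
  rw [lintegral_mul_const _ (by fun_prop)] at h2
  have hne : ENNReal.ofReal (Real.Gamma (d / 2 + 1) / 2) ≠ 0 := by
    simpa using by positivity
  rw [← ENNReal.mul_left_inj hne ENNReal.ofReal_ne_top, ← h2, ← ENNReal.ofReal_mul
    (mul_nonneg (ballVolume_pos d).le (by positivity)), ballVolume_eq hd]
  congr 1
  field_simp

/-! ### The normalized kernel: mass near the origin and decay away from it -/

/-- The normalized kernel `C_{d,s} |h|^{-(d-1+2s)}`. -/
def kappa (d : ℕ) (s : ℝ) (h : Euc d) : ℝ := scaling d s / ‖h‖ ^ ((d : ℝ) - 1 + 2 * s)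

lemma scaling_nonneg {d : ℕ} {s : ℝ} (hs : s ≤ 1 / 2) : 0 ≤ scaling d s :=
  div_nonneg (by linarith) (ballVolume_pos d).le

lemma kappa_nonneg {d : ℕ} {s : ℝ} (hs : s ≤ 1 / 2) (h : Euc d) : 0 ≤ kappa d s h :=
  div_nonneg (scaling_nonneg hs) (by positivity)

@[fun_prop]
lemma measurable_kappa (d : ℕ) (s : ℝ) : Measurable (kappa d s) := by
  unfold kappa; fun_prop

lemma kappa_neg (d : ℕ) (s : ℝ) (h : Euc d) : kappa d s (-h) = kappa d s h := by
  simp [kappa]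

/-- The Jacobian `r^(d-1)` reduces the kernel to `r^(-2s)`, whose integral over `(0,1)` is
`1/(1-2s)`. The factor `1 - 2s` of `scaling` cancels it, so the result does not depend on `s`. -/
lemma lintegral_radial_kappa {d : ℕ} (hd : 1 ≤ d) {s : ℝ} (hs : s < 1 / 2) :
    ∫⁻ r in Ioi (0 : ℝ), ENNReal.ofReal (r ^ (d - 1)) *
        (Iio (1 : ℝ)).indicator (fun r => ENNReal.ofReal
          (scaling d s / r ^ ((d : ℝ) - 1 + 2 * s))) r
      = ENNReal.ofReal (volume.real (Metric.ball (0 : Euc d) 1))⁻¹ := by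
  have h1 : ∀ r ∈ Ioi (0 : ℝ), ENNReal.ofReal (r ^ (d - 1)) *
        (Iio (1 : ℝ)).indicator (fun r => ENNReal.ofReal
          (scaling d s / r ^ ((d : ℝ) - 1 + 2 * s))) r
      = (Iio (1 : ℝ)).indicator (fun r => ENNReal.ofReal (scaling d s * r ^ (-(2 * s)))) r := by
    intro r hr
    have hr : 0 < r := hr
    by_cases h : r ∈ Iio (1 : ℝ)
    · rw [indicator_of_mem h, indicator_of_mem h, ← ENNReal.ofReal_mul (by positivity)]
      congr 1
      rw [← Real.rpow_natCast, Nat.cast_sub hd, Real.rpow_neg hr.le, Real.rpow_add hr]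
      have := Real.rpow_pos_of_pos hr ((d : ℝ) - 1)
      have := Real.rpow_pos_of_pos hr (2 * s)
      push_cast
      field_simp
    · rw [indicator_of_notMem h, indicator_of_notMem h, mul_zero]
  rw [setLIntegral_congr_fun measurableSet_Ioi h1, lintegral_indicator measurableSet_Iio,
    Measure.restrict_restrict measurableSet_Iio, Iio_inter_Ioi]
  have hint : IntegrableOn (fun r : ℝ => r ^ (-(2 * s))) (Ioo 0 1) :=
    (intervalIntegral.integrableOn_Ioo_rpow_iff one_pos).2 (by linarith)
  rw [← ofReal_integral_eq_lintegral_ofReal (hint.const_mul _)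
    ((ae_restrict_mem measurableSet_Ioo).mono fun r hr =>
      mul_nonneg (scaling_nonneg hs.le) (Real.rpow_nonneg hr.1.le _)),
    integral_const_mul, ← integral_Ioc_eq_integral_Ioo, ← intervalIntegral.integral_of_le zero_le_one,
    integral_rpow (Or.inl (by linarith))]
  congr 1
  rw [Real.one_rpow, Real.zero_rpow (by linarith), scaling]
  have : 1 - 2 * s ≠ 0 := by linarith
  have h2 : -(2 * s) + 1 ≠ 0 := by linarith
  have := (ballVolume_pos d).ne'
  field_simp
  ring

open Metric in
/-- Integrating `κ_s` against a function of the direction gives a spherical average. -/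
lemma lintegral_ball_kappa_mul_direction {d : ℕ} (hd : 1 ≤ d) {s : ℝ} (hs : s < 1 / 2)
    {k : Euc d → ENNReal} (hk : Measurable k) :
    ∫⁻ h in ball (0 : Euc d) 1, ENNReal.ofReal (kappa d s h) * k (‖h‖⁻¹ • h)
      = (∫⁻ θ : sphere (0 : Euc d) 1, k θ ∂(volume : Measure (Euc d)).toSphere) *
        ENNReal.ofReal (volume.real (ball (0 : Euc d) 1))⁻¹ := by
  have : Nonempty (Fin d) := ⟨⟨0, hd⟩⟩
  rw [← lintegral_radial_kappa hd hs]
  have h := lintegral_radial_mul_direction (volume : Measure (Euc d)) (k := k)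
    (p := (Iio (1 : ℝ)).indicator (fun r => ENNReal.ofReal
          (scaling d s / r ^ ((d : ℝ) - 1 + 2 * s))))
    (Measurable.indicator (by fun_prop) measurableSet_Iio) hk
  rw [finrank_euclideanSpace, Fintype.card_fin] at h
  rw [← h, ← lintegral_indicator measurableSet_ball]
  refine lintegral_congr fun x => ?_
  by_cases hx : x ∈ ball (0 : Euc d) 1
  · rw [indicator_of_mem hx, indicator_of_mem (by simpa using hx), kappa]
  · rw [indicator_of_notMem hx, indicator_of_notMem (by simpa using hx), zero_mul]

/-- The sphere has measure `d` times the ball volume, hence mass `d` for every `s`. -/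
lemma lintegral_ball_kappa {d : ℕ} (hd : 1 ≤ d) {s : ℝ} (hs : s < 1 / 2) :
    ∫⁻ h in Metric.ball (0 : Euc d) 1, ENNReal.ofReal (kappa d s h) = ENNReal.ofReal d := by
  have h := lintegral_ball_kappa_mul_direction hd hs (k := fun _ => 1) measurable_const
  simp only [mul_one, lintegral_const, one_mul, Measure.toSphere_apply_univ,
    finrank_euclideanSpace, Fintype.card_fin] at h
  rw [h]
  have hb := ballVolume_pos d
  rw [← ENNReal.ofReal_toReal (measure_ball_lt_top (μ := volume) (x := (0 : Euc d)) (r := 1)).ne,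
    ← ENNReal.ofReal_natCast, ← ENNReal.ofReal_mul (by positivity), ← ENNReal.ofReal_mul
    (by positivity)]
  congr 1
  simp only [Measure.real] at hb ⊢
  field_simp

lemma integrableOn_ball_kappa {d : ℕ} (hd : 1 ≤ d) {s : ℝ} (hs : s < 1 / 2) :
    IntegrableOn (kappa d s) (Metric.ball 0 1) := by
  refine (lintegral_ofReal_ne_top_iff_integrable (by fun_prop)
    (Eventually.of_forall (kappa_nonneg hs.le))).1 ?_
  rw [lintegral_ball_kappa hd hs]
  exact ENNReal.ofReal_ne_top

lemma integral_ball_kappa {d : ℕ} (hd : 1 ≤ d) {s : ℝ} (hs : s < 1 / 2) :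
    ∫ h in Metric.ball (0 : Euc d) 1, kappa d s h = d := by
  rw [integral_eq_lintegral_of_nonneg_ae (Eventually.of_forall (kappa_nonneg hs.le))
    (by fun_prop), lintegral_ball_kappa hd hs, ENNReal.toReal_ofReal (by positivity)]

/-- Since `d - 1 + 2s ≤ d` and `δ ≤ 1`, the power of `δ` can be made free of `s`; only `scaling`
still depends on `s`, and it tends to 0. -/
lemma kappa_le_of_le_norm {d : ℕ} (hd : 1 ≤ d) {s δ : ℝ} (hs : 0 < s) (hs' : s ≤ 1 / 2)
    (hδ : 0 < δ) (hδ1 : δ ≤ 1) {h : Euc d} (hh : δ ≤ ‖h‖) :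
    kappa d s h ≤ scaling d s / δ ^ d := by
  have hd' : (1 : ℝ) ≤ d := by exact_mod_cast hd
  refine div_le_div_of_nonneg_left (scaling_nonneg hs') (by positivity) ?_
  calc δ ^ d = δ ^ (d : ℝ) := (Real.rpow_natCast _ _).symm
    _ ≤ δ ^ ((d : ℝ) - 1 + 2 * s) := Real.rpow_le_rpow_of_exponent_ge hδ hδ1 (by linarith)
    _ ≤ _ := Real.rpow_le_rpow hδ.le hh (by linarith)

/-- The extra `‖h‖^(-2)` brings the decay to the power `d + 1 + 2s`, which is integrable at
infinity. The majorant depends on `s` through `scaling` alone; the constant `2^(d+1)` comes from `1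
+ ‖h‖ ≤ 2‖h‖`. -/
lemma kappa_div_norm_sq_le {d : ℕ} {s : ℝ} (hs : 0 < s) (hs' : s ≤ 1 / 2) {h : Euc d}
    (hh : 1 ≤ ‖h‖) :
    kappa d s h / ‖h‖ ^ 2
      ≤ scaling d s * (2 ^ ((d : ℝ) + 1) * (1 + ‖h‖) ^ (-((d : ℝ) + 1))) := by
  have h0 : 0 < ‖h‖ := by linarith
  have hd0 : (0 : ℝ) ≤ d := by positivity
  rw [kappa, div_div, div_eq_mul_inv]
  refine mul_le_mul_of_nonneg_left ?_ (scaling_nonneg hs')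
  rw [← Real.rpow_two, ← Real.rpow_add h0, Real.rpow_neg (by positivity), ← div_eq_mul_inv,
    le_div_iff₀ (by positivity), inv_mul_le_iff₀ (by positivity), mul_comm]
  calc (1 + ‖h‖) ^ ((d : ℝ) + 1) ≤ (2 * ‖h‖) ^ ((d : ℝ) + 1) :=
        Real.rpow_le_rpow (by positivity) (by linarith) (by positivity)
    _ = 2 ^ ((d : ℝ) + 1) * ‖h‖ ^ ((d : ℝ) + 1) := Real.mul_rpow (by norm_num) h0.le
    _ ≤ _ := mul_le_mul_of_nonneg_left
        (Real.rpow_le_rpow_of_exponent_le hh (by linarith)) (by positivity)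

/-! ### Directional averages of `G_{1/2}` -/

/-- The substitution `r = τ c` exposes the integrand of `lintegral_sphere_gKernel`, so that the
spherical integral can be taken under the `τ`-integral. -/
lemma G_mul_eq_integral (d : ℕ) (s t c : ℝ) :
    G d s (t * c) * (t * c) = t * ∫ τ in (0 : ℝ)..t, gKernel d s (τ * c) * c ^ 2 := by
  have h := intervalIntegral.smul_integral_comp_mul_right (a := 0) (b := t) (gKernel d s) c
  rw [zero_mul] at h
  rw [G_eq, ← h, intervalIntegral.integral_mul_const, smul_eq_mul]
  ring

lemma integral_one_add_sq_rpow (t : ℝ) :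
    ∫ τ in (0 : ℝ)..t, (1 + τ ^ 2) ^ (-(3 : ℝ) / 2) = t / √(1 + t ^ 2) := by
  have hder : ∀ x : ℝ, HasDerivAt (fun τ : ℝ => τ * (1 + τ ^ 2) ^ (-(1 : ℝ) / 2))
      ((1 + x ^ 2) ^ (-(3 : ℝ) / 2)) x := by
    intro x
    have hx : 0 < 1 + x ^ 2 := by positivity
    have h1 : HasDerivAt (fun τ : ℝ => 1 + τ ^ 2) (2 * x) x := by
      simpa using (hasDerivAt_pow 2 x).const_add 1
    have h2 := (hasDerivAt_id x).mul (h1.rpow_const (p := -(1 : ℝ) / 2) (Or.inl hx.ne'))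
    refine h2.congr_deriv ?_
    have e1 : (1 + x ^ 2) ^ (-(1 : ℝ) / 2) = (1 + x ^ 2) ^ (-(3 : ℝ) / 2) * (1 + x ^ 2) := by
      nth_rewrite 3 [← Real.rpow_one (1 + x ^ 2)]
      rw [← Real.rpow_add hx]
      norm_num
    rw [e1, show -(1 : ℝ) / 2 - 1 = -3 / 2 by norm_num]
    simp only [id]
    ring
  rw [intervalIntegral.integral_eq_sub_of_hasDerivAt (fun x _ => hder x)
    (Continuous.intervalIntegrable
      (Continuous.rpow_const (by fun_prop) fun x => Or.inl (by positivity)) _ _)]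
  rw [zero_mul, sub_zero, neg_div, Real.rpow_neg (by positivity), ← Real.sqrt_eq_rpow,
    div_eq_mul_inv]

-- Tonelli exchanges the sphere with the `τ`-interval. The inner integral is then a multiple of `(1
-- + τ²)^(-3/2)`, whose primitive is `τ / √(1 + τ²)`.
open Metric in
lemma lintegral_sphere_G {d : ℕ} (hd : 1 ≤ d) {e : Euc d} (he : ‖e‖ = 1) {t : ℝ} (ht : 0 ≤ t) :
    ∫⁻ θ : sphere (0 : Euc d) 1, ENNReal.ofReal
        (G d (1 / 2) (t * inner ℝ e (θ : Euc d)) * (t * inner ℝ e (θ : Euc d)))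
        ∂(volume : Measure (Euc d)).toSphere
      = ENNReal.ofReal (t * (volume.real (ball (0 : Euc d) 1) * (t / √(1 + t ^ 2)))) := by
  have hk := continuous_gKernel d (1 / 2)
  have h1 : ∀ c : ℝ, ENNReal.ofReal (G d (1 / 2) (t * c) * (t * c))
      = ENNReal.ofReal t * ∫⁻ τ in Ioc 0 t, ENNReal.ofReal (gKernel d (1 / 2) (τ * c) * c ^ 2) := by
    intro c
    rw [G_mul_eq_integral, ENNReal.ofReal_mul ht, intervalIntegral.integral_of_le ht,
      ofReal_integral_eq_lintegral_ofReal]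
    · exact (Continuous.integrableOn_Icc (by fun_prop)).mono_set Ioc_subset_Icc_self
    · exact Eventually.of_forall fun τ => mul_nonneg (gKernel_nonneg _ _ _) (sq_nonneg _)
  simp only [h1]
  have hcont : Continuous fun p : sphere (0 : Euc d) 1 × ℝ =>
      gKernel d (1 / 2) (p.2 * inner ℝ e (p.1 : Euc d)) * inner ℝ e (p.1 : Euc d) ^ 2 := by
    fun_prop
  have hmeas : Measurable fun p : sphere (0 : Euc d) 1 × ℝ => ENNReal.ofReal
      (gKernel d (1 / 2) (p.2 * inner ℝ e (p.1 : Euc d)) * inner ℝ e (p.1 : Euc d) ^ 2) :=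
    ENNReal.measurable_ofReal.comp hcont.measurable
  rw [lintegral_const_mul _ hmeas.lintegral_prod_right', lintegral_lintegral_swap
    hmeas.aemeasurable]
  simp only [lintegral_sphere_gKernel hd he]
  have hc : Continuous fun τ : ℝ => (1 + τ ^ 2) ^ (-(3 : ℝ) / 2) :=
    Continuous.rpow_const (by fun_prop) fun x => Or.inl (by positivity)
  rw [← ofReal_integral_eq_lintegral_ofReal
    ((Continuous.integrableOn_Icc (by fun_prop)).mono_set Ioc_subset_Icc_self)
    (Eventually.of_forall fun τ => mul_nonneg (ballVolume_pos d).le (by positivity)),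
    integral_const_mul, ← intervalIntegral.integral_of_le ht, integral_one_add_sq_rpow,
    ENNReal.ofReal_mul ht]

lemma abs_inner_direction_le {d : ℕ} (a h : Euc d) : |inner ℝ a (‖h‖⁻¹ • h)| ≤ ‖a‖ := by
  refine (abs_real_inner_le_norm _ _).trans ?_
  rcases eq_or_ne h 0 with rfl | hh
  · simp
  · rw [norm_smul, norm_inv, norm_norm, inv_mul_cancel₀ (norm_ne_zero_iff.2 hh), mul_one]

lemma integral_ball_kappa_mul_G_self {d : ℕ} (hd : 1 ≤ d) {s : ℝ} (hs : s < 1 / 2) (a : Euc d) :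
    ∫ h in Metric.ball (0 : Euc d) 1,
        kappa d s h * (G d (1 / 2) (inner ℝ a (‖h‖⁻¹ • h)) * inner ℝ a (‖h‖⁻¹ • h))
      = ‖a‖ ^ 2 / areaElement a := by
  rcases eq_or_ne a 0 with rfl | ha
  · simp
  have ht : 0 < ‖a‖ := norm_pos_iff.2 ha
  set t := ‖a‖ with ht_def
  set e : Euc d := t⁻¹ • a with he_def
  have he : ‖e‖ = 1 := by
    rw [he_def, norm_smul, norm_inv, Real.norm_of_nonneg ht.le, inv_mul_cancel₀ ht.ne']
  have hae : ∀ x, inner ℝ a x = t * inner ℝ e x := fun x => by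
    rw [he_def, inner_smul_left, conj_trivial, ← mul_assoc, mul_inv_cancel₀ ht.ne', one_mul]
  have hG := continuous_G (d := d) (s := 1 / 2) (by norm_num)
  have hGnn : ∀ x, 0 ≤ G d (1 / 2) x * x := fun x => by
    simpa [monoForm, G_zero] using monoForm_nonneg d (1 / 2) x 0
  rw [integral_eq_lintegral_of_nonneg_ae
    (Eventually.of_forall fun h => mul_nonneg (kappa_nonneg hs.le h) (hGnn _))
    (by fun_prop)]
  simp only [ENNReal.ofReal_mul (kappa_nonneg hs.le _)]
  have h := lintegral_ball_kappa_mul_direction hd hs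
    (k := fun x => ENNReal.ofReal (G d (1 / 2) (inner ℝ a x) * inner ℝ a x)) (by fun_prop)
  rw [h]
  simp only [hae]
  have hb := ballVolume_pos d
  rw [lintegral_sphere_G hd he ht.le, ← ENNReal.ofReal_mul (by positivity),
    ENNReal.toReal_ofReal (by positivity), areaElement, ← ht_def]
  field_simp

lemma integrableOn_kappa_mul_G {d : ℕ} (hd : 1 ≤ d) {s : ℝ} (hs : s < 1 / 2) (a c : Euc d) :
    IntegrableOn (fun h => kappa d s h *
      (G d (1 / 2) (inner ℝ a (‖h‖⁻¹ • h)) * inner ℝ c (‖h‖⁻¹ • h))) (Metric.ball 0 1) := by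
  have hG := continuous_G (d := d) (s := 1 / 2) (by norm_num)
  refine Integrable.mono' ((integrableOn_ball_kappa hd hs).mul_const (‖a‖ * ‖c‖)) (by fun_prop)
    (Eventually.of_forall fun h => ?_)
  rw [norm_mul, norm_mul, Real.norm_of_nonneg (kappa_nonneg hs.le h)]
  refine mul_le_mul_of_nonneg_left (mul_le_mul ?_ (abs_inner_direction_le c h)
    (norm_nonneg _) (norm_nonneg _)) (kappa_nonneg hs.le h)
  have := abs_G_sub_le (d := d) (s := 1 / 2) (by norm_num) (inner ℝ a (‖h‖⁻¹ • h)) 0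
  rw [G_zero, sub_zero, sub_zero] at this
  exact this.trans (abs_inner_direction_le a h)

/-- The reflection across the hyperplane orthogonal to `c` preserves the ball, the measure and
`κ_s`; it fixes `a` and negates `c`. The integral therefore equals its own negative. -/
lemma integral_ball_kappa_mul_G_of_inner_eq_zero {d : ℕ} {s : ℝ} {a c : Euc d}
    (hac : inner ℝ a c = 0) :
    ∫ h in Metric.ball (0 : Euc d) 1,
        kappa d s h * (G d (1 / 2) (inner ℝ a (‖h‖⁻¹ • h)) * inner ℝ c (‖h‖⁻¹ • h)) = 0 := by
  set R := (ℝ ∙ c)ᗮ.reflection with hR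
  have hRc : R c = -c := Submodule.reflection_orthogonalComplement_singleton_eq_neg c
  have hRa : R a = a := Submodule.reflection_mem_subspace_eq_self
    (Submodule.mem_orthogonal_singleton_iff_inner_left.2 hac)
  have h1 := R.measurePreserving.setIntegral_preimage_emb R.toHomeomorph.measurableEmbedding
    (fun h => kappa d s h * (G d (1 / 2) (inner ℝ a (‖h‖⁻¹ • h)) * inner ℝ c (‖h‖⁻¹ • h)))
    (Metric.ball 0 1)
  have h2 : R ⁻¹' Metric.ball 0 1 = Metric.ball 0 1 := by
    ext x; simp
  have h3 : ∀ b x, inner ℝ b (R x) = inner ℝ (R b) x := fun b x => by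
    rw [← R.inner_map_map b (R x), hR, Submodule.reflection_reflection]
  rw [h2] at h1
  simp only [← map_smul, h3, hRa, hRc, kappa, R.norm_map, inner_neg_left, mul_neg] at h1
  rw [integral_neg] at h1
  simp only [kappa]
  linarith

/-- The integral is linear in `c`: the component along `a` is the computed case `c = a`, and the
orthogonal component contributes nothing. -/
lemma integral_ball_kappa_mul_G {d : ℕ} (hd : 1 ≤ d) {s : ℝ} (hs : s < 1 / 2) (a c : Euc d) :
    ∫ h in Metric.ball (0 : Euc d) 1,
        kappa d s h * (G d (1 / 2) (inner ℝ a (‖h‖⁻¹ • h)) * inner ℝ c (‖h‖⁻¹ • h))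
      = inner ℝ a c / areaElement a := by
  rcases eq_or_ne a 0 with rfl | ha
  · simp [G_zero]
  have ha' : ‖a‖ ≠ 0 := norm_ne_zero_iff.2 ha
  set l : ℝ := inner ℝ a c / ‖a‖ ^ 2 with hl
  set p : Euc d := c - l • a with hp
  have hperp : inner ℝ a p = 0 := by
    rw [hp, inner_sub_right, inner_smul_right, real_inner_self_eq_norm_sq, hl]
    field_simp
    ring
  have hc : ∀ x, inner ℝ c x = l * inner ℝ a x + inner ℝ p x := fun x => by
    rw [hp, inner_sub_left, inner_smul_left, conj_trivial]; ring
  have h1 : ∀ h : Euc d, kappa d s h *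
        (G d (1 / 2) (inner ℝ a (‖h‖⁻¹ • h)) * inner ℝ c (‖h‖⁻¹ • h))
      = l * (kappa d s h * (G d (1 / 2) (inner ℝ a (‖h‖⁻¹ • h)) * inner ℝ a (‖h‖⁻¹ • h)))
        + kappa d s h * (G d (1 / 2) (inner ℝ a (‖h‖⁻¹ • h)) * inner ℝ p (‖h‖⁻¹ • h)) := by
    intro h; rw [hc]; ring
  simp only [h1]
  rw [integral_add ((integrableOn_kappa_mul_G hd hs a a).const_mul l)
    (integrableOn_kappa_mul_G hd hs a p), integral_const_mul,
    integral_ball_kappa_mul_G_self hd hs, integral_ball_kappa_mul_G_of_inner_eq_zero hperp, hl]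
  have := one_le_areaElement a
  field_simp
  ring

/-- The directional average of the nonlocal form is the local geometric form. -/
lemma integral_ball_kappa_mul_monoForm {d : ℕ} (hd : 1 ≤ d) {s : ℝ} (hs : s < 1 / 2)
    (a b : Euc d) :
    ∫ h in Metric.ball (0 : Euc d) 1,
        kappa d s h * monoForm d (1 / 2) (inner ℝ a (‖h‖⁻¹ • h)) (inner ℝ b (‖h‖⁻¹ • h))
      = ‖unitNormal a - unitNormal b‖ ^ 2 * ((areaElement a + areaElement b) / 2) := by
  have h1 : ∀ h : Euc d, kappa d s h *
        monoForm d (1 / 2) (inner ℝ a (‖h‖⁻¹ • h)) (inner ℝ b (‖h‖⁻¹ • h))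
      = kappa d s h * (G d (1 / 2) (inner ℝ a (‖h‖⁻¹ • h)) * inner ℝ (a - b) (‖h‖⁻¹ • h))
        - kappa d s h * (G d (1 / 2) (inner ℝ b (‖h‖⁻¹ • h)) * inner ℝ (a - b) (‖h‖⁻¹ • h)) := by
    intro h; rw [monoForm, inner_sub_left]; ring
  simp only [h1]
  rw [integral_sub (integrableOn_kappa_mul_G hd hs a _) (integrableOn_kappa_mul_G hd hs b _),
    integral_ball_kappa_mul_G hd hs, integral_ball_kappa_mul_G hd hs, norm_unitNormal_sub_sq_mul]

/-! ### Functions in `H¹(ℝ^d)` and their translates -/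

/-- `(u, g)` is an `L²` limit of pairs `(φ, ∇φ)` with `φ ∈ C_c^∞(ℝ^d)`; that is, `u ∈ H¹(ℝ^d)`
has gradient `g`. -/
def HasStrongGradient {d : ℕ} (u : Euc d → ℝ) (g : Euc d → Euc d) : Prop :=
  MemLp u 2 volume ∧ MemLp g 2 volume ∧ ∃ φ : ℕ → Euc d → ℝ,
    (∀ n, ContDiff ℝ ∞ (φ n) ∧ HasCompactSupport (φ n)) ∧
    Tendsto (fun n => eLpNorm (fun x => u x - φ n x) 2 volume) atTop (𝓝 0) ∧
    Tendsto (fun n => eLpNorm (fun x => g x - ∇ (φ n) x) 2 volume) atTop (𝓝 0)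

lemma inner_gradient_eq_fderiv {d : ℕ} (φ : Euc d → ℝ) (x h : Euc d) :
    inner ℝ (∇ φ x) h = fderiv ℝ φ x h := by
  rw [gradient, InnerProductSpace.toDual_symm_apply]

lemma continuous_gradient {d : ℕ} {φ : Euc d → ℝ} (hφ : ContDiff ℝ ∞ φ) : Continuous (∇ φ) :=
  (InnerProductSpace.toDual ℝ (Euc d)).symm.continuous.comp (hφ.continuous_fderiv (by simp))

lemma tsupport_gradient_subset {d : ℕ} (φ : Euc d → ℝ) : tsupport (∇ φ) ⊆ tsupport φ := by
  refine (closure_mono fun x hx => ?_).trans (tsupport_fderiv_subset ℝ (f := φ))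
  rw [Function.mem_support] at hx ⊢
  contrapose! hx
  rw [gradient, hx, map_zero]

lemma eLpNorm_two_sq {α F : Type*} [MeasurableSpace α] [NormedAddCommGroup F] (μ : Measure α)
    (f : α → F) : eLpNorm f 2 μ ^ 2 = ∫⁻ x, ‖f x‖ₑ ^ 2 ∂μ := by
  have := eLpNorm_nnreal_pow_eq_lintegral (f := f) (μ := μ) (p := 2) (by norm_num)
  simpa using this

lemma sq_lintegral_le {α : Type*} [MeasurableSpace α] {μ : Measure α} [IsProbabilityMeasure μ]
    {f : α → ENNReal} (hf : AEMeasurable f μ) : (∫⁻ x, f x ∂μ) ^ 2 ≤ ∫⁻ x, f x ^ 2 ∂μ := by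
  have h := ENNReal.lintegral_mul_le_Lp_mul_Lq μ Real.HolderConjugate.two_two hf
    (aemeasurable_const (b := (1 : ENNReal)))
  simp only [Pi.mul_apply, mul_one, ENNReal.one_rpow, lintegral_const, measure_univ,
    ENNReal.rpow_two, one_pow] at h
  calc (∫⁻ x, f x ∂μ) ^ 2 ≤ ((∫⁻ x, f x ^ 2 ∂μ) ^ (1 / 2 : ℝ)) ^ 2 := by gcongr
    _ = _ := by rw [← ENNReal.rpow_two, ← ENNReal.rpow_mul]; norm_num

lemma eLpNorm_comp_add_right {d : ℕ} {F : Type*} [NormedAddCommGroup F] {f : Euc d → F}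
    (hf : AEStronglyMeasurable f volume) (h : Euc d) (p : ENNReal) :
    eLpNorm (fun x => f (x + h)) p volume = eLpNorm f p volume :=
  eLpNorm_comp_measurePreserving hf (measurePreserving_add_right volume h)

/-- The increment is the integral of `∇φ · h` along the segment from `x` to `x + h`. Jensen on
`[0,1]`, Tonelli and translation invariance of the measure give the bound. -/
lemma eLpNorm_translate_sub_le_of_contDiff {d : ℕ} {φ : Euc d → ℝ} (hφ : ContDiff ℝ ∞ φ)
    (h : Euc d) :
    eLpNorm (fun x => φ (x + h) - φ x) 2 volume ≤ ‖h‖ₑ * eLpNorm (∇ φ) 2 volume := by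
  have hc := continuous_gradient hφ
  rw [← ENNReal.pow_le_pow_left_iff (n := 2) (by norm_num), mul_pow, eLpNorm_two_sq,
    eLpNorm_two_sq]
  have hpt : ∀ x, ‖φ (x + h) - φ x‖ₑ ^ 2
      ≤ ‖h‖ₑ ^ 2 * ∫⁻ t in Ioc (0 : ℝ) 1, ‖∇ φ (x + t • h)‖ₑ ^ 2 := by
    intro x
    have hder : ∀ t : ℝ, HasDerivAt (fun t : ℝ => φ (x + t • h)) (inner ℝ (∇ φ (x + t • h)) h) t := by
      intro t
      rw [inner_gradient_eq_fderiv]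
      have h1 : HasDerivAt (fun t : ℝ => x + t • h) h t := by
        simpa using ((hasDerivAt_id t).smul_const h).const_add x
      exact ((hφ.differentiable (by simp)) _).hasFDerivAt.comp_hasDerivAt t h1
    have h2 := intervalIntegral.integral_eq_sub_of_hasDerivAt (a := 0) (b := 1)
      (fun t _ => hder t) (Continuous.intervalIntegrable (by fun_prop) _ _)
    simp only [one_smul, zero_smul, add_zero] at h2
    have hprob : IsProbabilityMeasure (volume.restrict (Ioc (0 : ℝ) 1)) := ⟨by simp⟩
    calc ‖φ (x + h) - φ x‖ₑ ^ 2 ≤ (∫⁻ t in Ioc (0 : ℝ) 1, ‖h‖ₑ * ‖∇ φ (x + t • h)‖ₑ) ^ 2 := by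
          rw [← h2, intervalIntegral.integral_of_le zero_le_one]
          gcongr
          refine (enorm_integral_le_lintegral_enorm _).trans (lintegral_mono fun t => ?_)
          rw [mul_comm, ← enorm_norm h, ← enorm_norm (∇ φ _), ← enorm_mul]
          exact enorm_le_iff_norm_le.2 (by simpa using abs_real_inner_le_norm (∇ φ (x + t • h)) h)
      _ ≤ ∫⁻ t in Ioc (0 : ℝ) 1, (‖h‖ₑ * ‖∇ φ (x + t • h)‖ₑ) ^ 2 :=
          sq_lintegral_le (Continuous.aemeasurable (by fun_prop (disch := simp)) |>.const_mul _)
      _ = _ := by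
          simp only [mul_pow]
          rw [lintegral_const_mul' _ _ (by simp)]
  refine (lintegral_mono hpt).trans ?_
  rw [lintegral_const_mul' _ _ (by simp)]
  refine mul_le_mul' le_rfl ?_
  rw [lintegral_lintegral_swap (Measurable.aemeasurable (by
    have : Continuous fun p : Euc d × ℝ => ∇ φ (p.1 + p.2 • h) := by fun_prop
    exact this.measurable.enorm.pow_const 2))]
  have h3 : ∀ t : ℝ, ∫⁻ x, ‖∇ φ (x + t • h)‖ₑ ^ 2 = ∫⁻ x, ‖∇ φ x‖ₑ ^ 2 := fun t =>
    lintegral_add_right_eq_self (fun x => ‖∇ φ x‖ₑ ^ 2) (t • h)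
  simp [h3]

lemma gradient_sub {d : ℕ} {φ ψ : Euc d → ℝ} (hφ : ContDiff ℝ ∞ φ) (hψ : ContDiff ℝ ∞ ψ)
    (x : Euc d) : ∇ (fun y => φ y - ψ y) x = ∇ φ x - ∇ ψ x := by
  simp only [gradient]
  rw [fderiv_fun_sub ((hφ.differentiable (by simp)) x) ((hψ.differentiable (by simp)) x), map_sub]

lemma tendsto_eLpNorm_sub_zero {α F : Type*} [MeasurableSpace α] [NormedAddCommGroup F]
    {μ : Measure α} {ι : Type*} {l : Filter ι} {f g : ι → α → F}
    (hfm : ∀ i, AEStronglyMeasurable (f i) μ) (hgm : ∀ i, AEStronglyMeasurable (g i) μ)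
    (hf : Tendsto (fun i => eLpNorm (f i) 2 μ) l (𝓝 0))
    (hg : Tendsto (fun i => eLpNorm (g i) 2 μ) l (𝓝 0)) :
    Tendsto (fun i => eLpNorm (fun x => f i x - g i x) 2 μ) l (𝓝 0) := by
  have := hf.add hg
  rw [add_zero] at this
  exact tendsto_of_tendsto_of_tendsto_of_le_of_le tendsto_const_nhds this (fun _ => zero_le)
    fun i => eLpNorm_sub_le (hfm i) (hgm i) (by norm_num)

lemma HasStrongGradient.sub {d : ℕ} {u v : Euc d → ℝ} {g k : Euc d → Euc d}
    (hu : HasStrongGradient u g) (hv : HasStrongGradient v k) :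
    HasStrongGradient (fun x => u x - v x) (fun x => g x - k x) := by
  obtain ⟨hu2, hg2, φ, hφ, hφ0, hφ1⟩ := hu
  obtain ⟨hv2, hk2, ψ, hψ, hψ0, hψ1⟩ := hv
  refine ⟨hu2.sub hv2, hg2.sub hk2, fun n x => φ n x - ψ n x, fun n =>
    ⟨(hφ n).1.sub (hψ n).1, (hφ n).2.sub (hψ n).2⟩, ?_, ?_⟩
  · have := tendsto_eLpNorm_sub_zero
      (fun n => hu2.1.sub (hφ n).1.continuous.aestronglyMeasurable)
      (fun n => hv2.1.sub (hψ n).1.continuous.aestronglyMeasurable) hφ0 hψ0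
    refine this.congr fun n => congrArg (fun f => eLpNorm f 2 volume) (funext fun x => ?_)
    simp only [Pi.sub_apply]
    ring
  · have := tendsto_eLpNorm_sub_zero
      (fun n => hg2.1.sub (continuous_gradient (hφ n).1).aestronglyMeasurable)
      (fun n => hk2.1.sub (continuous_gradient (hψ n).1).aestronglyMeasurable) hφ1 hψ1
    refine this.congr fun n => congrArg (fun f => eLpNorm f 2 volume) (funext fun x => ?_)
    rw [gradient_sub (hφ n).1 (hψ n).1]
    simp only [Pi.sub_apply]
    abel

lemma hasStrongGradient_of_contDiff {d : ℕ} {φ : Euc d → ℝ} (hφ : ContDiff ℝ ∞ φ)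
    (hc : HasCompactSupport φ) : HasStrongGradient φ (∇ φ) := by
  refine ⟨hφ.continuous.memLp_of_hasCompactSupport hc,
    (continuous_gradient hφ).memLp_of_hasCompactSupport
      (hc.of_isClosed_subset (isClosed_tsupport _) (tsupport_gradient_subset φ)),
    fun _ => φ, fun _ => ⟨hφ, hc⟩, ?_, ?_⟩ <;> simp

lemma HasStrongGradient.eLpNorm_translate_sub_le {d : ℕ} {u : Euc d → ℝ} {g : Euc d → Euc d}
    (hu : HasStrongGradient u g) (h : Euc d) :
    eLpNorm (fun x => u (x + h) - u x) 2 volume ≤ ‖h‖ₑ * eLpNorm g 2 volume := by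
  obtain ⟨hu2, hg2, φ, hφ, hφ0, hφ1⟩ := hu
  have hlim : Tendsto (fun n => (eLpNorm (fun x => u x - φ n x) 2 volume
      + ‖h‖ₑ * (eLpNorm g 2 volume + eLpNorm (fun x => g x - ∇ (φ n) x) 2 volume))
      + eLpNorm (fun x => u x - φ n x) 2 volume) atTop
      (𝓝 ((0 + ‖h‖ₑ * (eLpNorm g 2 volume + 0)) + 0)) :=
    (hφ0.add (ENNReal.Tendsto.const_mul (tendsto_const_nhds.add hφ1) (Or.inr (by simp)))).add hφ0
  simp only [add_zero, zero_add] at hlim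
  refine ge_of_tendsto' hlim fun n => ?_
  have hm : AEStronglyMeasurable (fun x => u x - φ n x) volume :=
    hu2.1.sub (hφ n).1.continuous.aestronglyMeasurable
  have hmt : AEStronglyMeasurable (fun x => u (x + h) - φ n (x + h)) volume :=
    hm.comp_measurePreserving (measurePreserving_add_right volume h)
  have hc := (hφ n).1.continuous
  have hgm := (continuous_gradient (hφ n).1).aestronglyMeasurable (μ := volume)
  have e1 : (fun x => u (x + h) - u x) = (fun x => ((u (x + h) - φ n (x + h))
      + (φ n (x + h) - φ n x)) - (u x - φ n x)) := by
    funext x; ring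
  rw [e1]
  refine (eLpNorm_sub_le (hmt.add (Continuous.aestronglyMeasurable (by fun_prop))) hm
    (by norm_num)).trans (add_le_add ?_ le_rfl)
  refine (eLpNorm_add_le hmt (Continuous.aestronglyMeasurable (by fun_prop))
    (by norm_num)).trans (add_le_add ?_ ?_)
  · exact (eLpNorm_comp_add_right hm h 2).le
  · refine (eLpNorm_translate_sub_le_of_contDiff (hφ n).1 h).trans (mul_le_mul' le_rfl ?_)
    have e2 : ∇ (φ n) = fun x => g x - (g x - ∇ (φ n) x) := by funext x; abel
    nth_rewrite 1 [e2]
    exact eLpNorm_sub_le hg2.1 (hg2.1.sub hgm) (by norm_num)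

/-! ### Difference quotients and directional derivatives -/

/-- The difference quotient `(u(x + h) - u(x)) / |h|`. -/
def incQuot {d : ℕ} (u : Euc d → ℝ) (h x : Euc d) : ℝ := (u (x + h) - u x) / ‖h‖

lemma incQuot_sub {d : ℕ} (u v : Euc d → ℝ) (h x : Euc d) :
    incQuot (fun y => u y - v y) h x = incQuot u h x - incQuot v h x := by
  unfold incQuot; ring

lemma aestronglyMeasurable_incQuot {d : ℕ} {u : Euc d → ℝ}
    (hu : AEStronglyMeasurable u volume) (h : Euc d) :
    AEStronglyMeasurable (incQuot u h) volume :=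
  (((hu.comp_measurePreserving (measurePreserving_add_right volume h)).sub hu).aemeasurable.div_const
    ‖h‖).aestronglyMeasurable

lemma eLpNorm_incQuot {d : ℕ} (u : Euc d → ℝ) {h : Euc d} (hh : h ≠ 0) :
    eLpNorm (incQuot u h) 2 volume
      = ‖h‖ₑ⁻¹ * eLpNorm (fun x => u (x + h) - u x) 2 volume := by
  have e : incQuot u h = ‖h‖⁻¹ • (fun x => u (x + h) - u x) := by
    funext x; simp [incQuot, div_eq_inv_mul]
  rw [e, eLpNorm_const_smul, enorm_inv (norm_ne_zero_iff.2 hh), enorm_norm]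

lemma HasStrongGradient.eLpNorm_incQuot_le {d : ℕ} {u : Euc d → ℝ} {g : Euc d → Euc d}
    (hu : HasStrongGradient u g) {h : Euc d} (hh : h ≠ 0) :
    eLpNorm (incQuot u h) 2 volume ≤ eLpNorm g 2 volume := by
  rw [eLpNorm_incQuot u hh]
  refine (mul_le_mul' le_rfl (hu.eLpNorm_translate_sub_le h)).trans ?_
  rw [← mul_assoc, ENNReal.inv_mul_cancel (by simpa using hh) (by simp), one_mul]

/-- For large increments this bound beats the one by the gradient: its decay in `‖h‖` makes the tail
integral converge. -/
lemma eLpNorm_incQuot_le_of_memLp {d : ℕ} {u : Euc d → ℝ} (hu : AEStronglyMeasurable u volume)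
    {h : Euc d} (hh : h ≠ 0) :
    eLpNorm (incQuot u h) 2 volume ≤ ‖h‖ₑ⁻¹ * (2 * eLpNorm u 2 volume) := by
  rw [eLpNorm_incQuot u hh]
  refine mul_le_mul' le_rfl ((eLpNorm_sub_le (hu.comp_measurePreserving
    (measurePreserving_add_right volume h)) hu (by norm_num)).trans ?_)
  rw [two_mul]
  exact add_le_add (eLpNorm_comp_add_right hu h 2).le le_rfl

lemma eLpNorm_inner_direction_le {d : ℕ} (g : Euc d → Euc d) (h : Euc d) :
    eLpNorm (fun x => inner ℝ (g x) (‖h‖⁻¹ • h)) 2 volume ≤ eLpNorm g 2 volume :=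
  eLpNorm_mono fun x => abs_inner_direction_le (g x) h

/-- Since `fderiv ℝ φ` is Lipschitz, the Taylor remainder divided by `‖h‖` is at most `C * ‖h‖`
everywhere. For `‖h‖ ≤ 1` it is supported in one fixed ball, so the uniform bound passes to `L²`. -/
lemma tendsto_incQuot_of_contDiff {d : ℕ} {φ : Euc d → ℝ} (hφ : ContDiff ℝ ∞ φ)
    (hc : HasCompactSupport φ) :
    Tendsto (fun h : Euc d => eLpNorm (fun x => incQuot φ h x - inner ℝ (∇ φ x) (‖h‖⁻¹ • h)) 2
      volume) (𝓝[≠] 0) (𝓝 0) := by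
  obtain ⟨C, hC⟩ := ContDiff.lipschitzWith_of_hasCompactSupport (𝕂 := ℝ) (n := ∞)
    (hc.fderiv ℝ) (hφ.fderiv_right (by simp)) (by simp)
  obtain ⟨R, hR⟩ := hc.isCompact.isBounded.subset_closedBall (0 : Euc d)
  have hbound : ∀ h : Euc d, h ≠ 0 → ∀ x,
      ‖incQuot φ h x - inner ℝ (∇ φ x) (‖h‖⁻¹ • h)‖ ≤ C * ‖h‖ := by
    intro h hh x
    have hh' : 0 < ‖h‖ := norm_pos_iff.2 hh
    have h1 := Convex.norm_image_sub_le_of_norm_fderiv_le' (𝕜 := ℝ) (f := φ)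
      (φ := fderiv ℝ φ x) (C := C * ‖h‖) (s := Metric.closedBall x ‖h‖) (x := x) (y := x + h)
      (fun z _ => (hφ.differentiable (by simp)) z)
      (fun z hz => (hC.norm_sub_le z x).trans (by
        gcongr; simpa [dist_eq_norm] using hz))
      (convex_closedBall _ _) (by simp) (by simp)
    rw [add_sub_cancel_left] at h1
    have e : incQuot φ h x - inner ℝ (∇ φ x) (‖h‖⁻¹ • h)
        = ‖h‖⁻¹ * (φ (x + h) - φ x - fderiv ℝ φ x h) := by
      rw [inner_smul_right, inner_gradient_eq_fderiv, incQuot]; ring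
    rw [e, norm_mul, norm_inv, norm_norm, inv_mul_le_iff₀ hh']
    linarith
  have hsupp : ∀ h : Euc d, ‖h‖ ≤ 1 → (Function.support fun x =>
      incQuot φ h x - inner ℝ (∇ φ x) (‖h‖⁻¹ • h)) ⊆ Metric.closedBall 0 (R + 1) := by
    intro h hh x hx
    by_contra hcon
    have hx0 : R + 1 < ‖x‖ := by simpa using hcon
    have h1 : x ∉ tsupport φ := fun hmem => by
      have := hR hmem
      rw [mem_closedBall_zero_iff] at this
      linarith
    have h2 : x + h ∉ tsupport φ := fun hmem => by
      have := hR hmem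
      rw [mem_closedBall_zero_iff] at this
      have h3 : ‖x‖ ≤ ‖x + h‖ + ‖h‖ := by simpa using norm_sub_le (x + h) h
      linarith
    have h3 : ∇ φ x = 0 := image_eq_zero_of_notMem_tsupport
      fun hmem => h1 (tsupport_gradient_subset φ hmem)
    apply hx
    simp [incQuot, h3, image_eq_zero_of_notMem_tsupport h1, image_eq_zero_of_notMem_tsupport h2]
  set V := volume (Metric.closedBall (0 : Euc d) (R + 1)) with hV
  have hV' : V ^ ((2 : ENNReal).toReal)⁻¹ ≠ ⊤ :=
    ENNReal.rpow_ne_top_of_nonneg (by positivity) measure_closedBall_lt_top.ne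
  have hlim : Tendsto (fun h : Euc d => V ^ ((2 : ENNReal).toReal)⁻¹ * ENNReal.ofReal (C * ‖h‖))
      (𝓝[≠] 0) (𝓝 0) := by
    have : Tendsto (fun h : Euc d => ENNReal.ofReal (C * ‖h‖)) (𝓝[≠] 0) (𝓝 0) := by
      have hcont : Continuous fun h : Euc d => ENNReal.ofReal (C * ‖h‖) :=
        ENNReal.continuous_ofReal.comp (by fun_prop)
      simpa using (hcont.tendsto 0).mono_left nhdsWithin_le_nhds
    simpa using ENNReal.Tendsto.const_mul this (Or.inr hV')
  refine tendsto_of_tendsto_of_tendsto_of_le_of_le' tendsto_const_nhds hlim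
    (Eventually.of_forall fun _ => zero_le) ?_
  filter_upwards [self_mem_nhdsWithin, nhdsWithin_le_nhds (Metric.closedBall_mem_nhds 0 one_pos)]
    with h hh hh1
  rw [← eLpNorm_restrict_eq_of_support_subset (hsupp h (by simpa using hh1))]
  refine (eLpNorm_le_of_ae_bound (Eventually.of_forall (hbound h hh))).trans ?_
  rw [Measure.restrict_apply_univ]

/-- Difference quotients of an `H¹` function converge in `L²` to the directional derivative,
uniformly in the direction. -/
lemma HasStrongGradient.tendsto_incQuot {d : ℕ} {u : Euc d → ℝ} {g : Euc d → Euc d}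
    (hu : HasStrongGradient u g) :
    Tendsto (fun h : Euc d => eLpNorm (fun x => incQuot u h x - inner ℝ (g x) (‖h‖⁻¹ • h)) 2
      volume) (𝓝[≠] 0) (𝓝 0) := by
  have hu' := hu
  obtain ⟨hu2, hg2, φ, hφ, hφ0, hφ1⟩ := hu'
  rw [ENNReal.tendsto_nhds_zero]
  intro ε hε
  have hε3 : 0 < ε / 3 := ENNReal.div_pos hε.ne' (by norm_num)
  -- One smooth approximant serves all increments: both the difference quotient and the directional
  -- derivative of the remainder `u - φ n` are bounded by `‖g - ∇ (φ n)‖` independently of `h`.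
  obtain ⟨n, hn⟩ := ((ENNReal.tendsto_nhds_zero.1 hφ1) _ hε3).exists
  have hφn := (hφ n).1
  have hgm := (continuous_gradient hφn).aestronglyMeasurable (μ := volume)
  have hw := hu.sub (hasStrongGradient_of_contDiff hφn (hφ n).2)
  filter_upwards [self_mem_nhdsWithin,
    (ENNReal.tendsto_nhds_zero.1 (tendsto_incQuot_of_contDiff hφn (hφ n).2)) _ hε3] with h hh hh2
  have e : (fun x => incQuot u h x - inner ℝ (g x) (‖h‖⁻¹ • h)) = fun x =>
      (incQuot (fun y => u y - φ n y) h x + (incQuot (φ n) h x - inner ℝ (∇ (φ n) x) (‖h‖⁻¹ • h)))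
        - inner ℝ (g x - ∇ (φ n) x) (‖h‖⁻¹ • h) := by
    funext x
    rw [incQuot_sub, inner_sub_left]; ring
  have m1 := aestronglyMeasurable_incQuot hw.1.1 h
  have m2 := (aestronglyMeasurable_incQuot hφn.continuous.aestronglyMeasurable h).sub
    (hgm.inner (𝕜 := ℝ) (aestronglyMeasurable_const (b := ‖h‖⁻¹ • h)))
  have m3 := (hg2.1.sub hgm).inner (𝕜 := ℝ) (aestronglyMeasurable_const (b := ‖h‖⁻¹ • h))
  rw [e]
  calc _ ≤ (ε / 3 + ε / 3) + ε / 3 := by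
        refine (eLpNorm_sub_le (m1.add m2) m3 (by norm_num)).trans (add_le_add
          ((eLpNorm_add_le m1 m2 (by norm_num)).trans (add_le_add ?_ hh2)) ?_)
        · exact (hw.eLpNorm_incQuot_le hh).trans hn
        · exact (eLpNorm_inner_direction_le _ h).trans hn
    _ = ε := ENNReal.add_thirds ε

/-! ### From `H^1_0(Λ)` to `H¹(ℝ^d)`, and uniqueness of weak gradients -/

lemma IsTestFunction.mono {d : ℕ} {U V : Set (Euc d)} {φ : Euc d → ℝ} (hφ : IsTestFunction U φ)
    (hUV : U ⊆ V) : IsTestFunction V φ := ⟨hφ.1, hφ.2.1, hφ.2.2.trans hUV⟩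

lemma IsTestFunction.eq_zero {d : ℕ} {U : Set (Euc d)} {φ : Euc d → ℝ} (hφ : IsTestFunction U φ)
    {x : Euc d} (hx : x ∉ U) : φ x = 0 :=
  image_eq_zero_of_notMem_tsupport fun h => hx (hφ.2.2 h)

lemma IsTestFunction.gradient_eq_zero {d : ℕ} {U : Set (Euc d)} {φ : Euc d → ℝ}
    (hφ : IsTestFunction U φ) {x : Euc d} (hx : x ∉ U) : ∇ φ x = 0 :=
  image_eq_zero_of_notMem_tsupport fun h => hx (hφ.2.2 (tsupport_gradient_subset φ h))

lemma HasWeakGradientOn.mono {d : ℕ} {U V : Set (Euc d)} {u : Euc d → ℝ} {g : Euc d → Euc d}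
    (h : HasWeakGradientOn V u g) (hUV : U ⊆ V) : HasWeakGradientOn U u g := by
  refine ⟨h.1.mono_set hUV, h.2.1.mono_set hUV, fun φ hφ => ?_⟩
  have h1 := h.2.2 φ (hφ.mono hUV)
  rw [setIntegral_eq_integral_of_forall_compl_eq_zero fun x hx => by
      rw [(hφ.mono hUV).gradient_eq_zero hx, smul_zero],
    setIntegral_eq_integral_of_forall_compl_eq_zero fun x hx => by
      rw [(hφ.mono hUV).eq_zero hx, zero_smul]] at h1
  rw [setIntegral_eq_integral_of_forall_compl_eq_zero fun x hx => by
      rw [hφ.gradient_eq_zero hx, smul_zero],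
    setIntegral_eq_integral_of_forall_compl_eq_zero fun x hx => by
      rw [hφ.eq_zero hx, zero_smul]]
  exact h1

lemma IsTestFunction.integrable_smul {d : ℕ} {U : Set (Euc d)} {φ : Euc d → ℝ}
    (hφ : IsTestFunction U φ) {g : Euc d → Euc d} (hg : LocallyIntegrableOn g U) :
    Integrable (fun x => φ x • g x) := by
  have h1 : IntegrableOn g (tsupport φ) := hg.integrableOn_compact_subset hφ.2.2 hφ.2.1.isCompact
  have h2 : IntegrableOn (fun x => φ x • g x) (tsupport φ) :=
    h1.continuousOn_smul hφ.1.continuous.continuousOn hφ.2.1.isCompact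
  refine (integrableOn_iff_integrable_of_support_subset fun x hx => ?_).1 h2
  by_contra hcon
  exact hx (by simp [image_eq_zero_of_notMem_tsupport hcon])

/-- The fundamental lemma of the calculus of variations applied to `g - k`. It makes the arbitrary
choice inside `weakGradient` harmless. -/
lemma HasWeakGradientOn.ae_eq {d : ℕ} {U : Set (Euc d)} (hU : IsOpen U) {u : Euc d → ℝ}
    {g k : Euc d → Euc d} (hg : HasWeakGradientOn U u g) (hk : HasWeakGradientOn U u k) :
    ∀ᵐ x, x ∈ U → g x = k x := by
  have h := hU.ae_eq_zero_of_integral_contDiff_smul_eq_zero (f := fun x => g x - k x)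
    (hg.2.1.sub hk.2.1) (fun φ h1 h2 h3 => by
      have hφ : IsTestFunction U φ := ⟨h1, h2, h3⟩
      have e := (hg.2.2 φ hφ).symm.trans (hk.2.2 φ hφ)
      rw [neg_inj, setIntegral_eq_integral_of_forall_compl_eq_zero fun x hx => by
          rw [hφ.eq_zero hx, zero_smul],
        setIntegral_eq_integral_of_forall_compl_eq_zero fun x hx => by
          rw [hφ.eq_zero hx, zero_smul]] at e
      simp only [smul_sub]
      rw [integral_sub (hφ.integrable_smul hg.2.1) (hφ.integrable_smul hk.2.1), e, sub_self])
  filter_upwards [h] with x hx hxU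
  exact sub_eq_zero.1 (hx hxU)

lemma weakGradient_ae_eq {d : ℕ} {U : Set (Euc d)} (hU : IsOpen U) {u : Euc d → ℝ}
    {g : Euc d → Euc d} (hg : HasWeakGradientOn U u g) :
    ∀ᵐ x, x ∈ U → weakGradient U u x = g x := by
  have hex : ∃ g, HasWeakGradientOn U u g := ⟨g, hg⟩
  rw [weakGradient, dif_pos hex]
  exact hex.choose_spec.ae_eq hU hg

/-- The gradient on `Λ` is extended by zero. The approximating test functions and their gradients
vanish off `Λ`, so convergence on `Λ` is already convergence on the whole space. -/
lemma MemH10.exists_hasStrongGradient {d : ℕ} {Ω Λ : Set (Euc d)} (hΩ : IsOpen Ω)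
    (hΛ : IsOpen Λ) (hΩΛ : Ω ⊆ Λ) {u : Euc d → ℝ} (hu : MemH10 Λ u) :
    ∃ g, HasStrongGradient u g ∧ ∀ᵐ x, x ∈ Ω → weakGradient Ω u x = g x := by
  obtain ⟨hu0, hu2, g, hg, hg2, φ, hφ, hφ0, hφ1⟩ := hu
  have hum : ∀ n, (fun x => u x - φ n x) =ᵐ[volume] Λ.indicator (fun x => u x - φ n x) := by
    intro n
    filter_upwards [hu0] with x hx
    by_cases hxΛ : x ∈ Λ
    · rw [indicator_of_mem hxΛ]
    · rw [indicator_of_notMem hxΛ, hx hxΛ, (hφ n).eq_zero hxΛ, sub_zero]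
  have hgm : ∀ n, (fun x => Λ.indicator g x - ∇ (φ n) x) = Λ.indicator fun x => g x - ∇ (φ n) x := by
    intro n
    funext x
    by_cases hxΛ : x ∈ Λ
    · rw [indicator_of_mem hxΛ, indicator_of_mem hxΛ]
    · rw [indicator_of_notMem hxΛ, indicator_of_notMem hxΛ, (hφ n).gradient_eq_zero hxΛ, sub_zero]
  refine ⟨Λ.indicator g, ⟨?_, ?_, φ, fun n => ⟨(hφ n).1, (hφ n).2.1⟩, ?_, ?_⟩, ?_⟩
  · refine ((memLp_indicator_iff_restrict hΛ.measurableSet).2 hu2).ae_eq ?_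
    filter_upwards [hu0] with x hx
    by_cases hxΛ : x ∈ Λ
    · rw [indicator_of_mem hxΛ]
    · rw [indicator_of_notMem hxΛ, hx hxΛ]
  · exact (memLp_indicator_iff_restrict hΛ.measurableSet).2 hg2
  · refine hφ0.congr fun n => ?_
    rw [eLpNorm_congr_ae (hum n), eLpNorm_indicator_eq_eLpNorm_restrict hΛ.measurableSet]
  · refine hφ1.congr fun n => ?_
    rw [hgm n, eLpNorm_indicator_eq_eLpNorm_restrict hΛ.measurableSet]
  · filter_upwards [weakGradient_ae_eq hΩ (hg.mono hΩΛ)] with x hx hxΩ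
    rw [hx hxΩ, indicator_of_mem (hΩΛ hxΩ)]

/-! ### Symmetrization and the change of variables `y = x + h` -/

lemma aestronglyMeasurable_monoForm {α : Type*} [MeasurableSpace α] {μ : Measure α} {d : ℕ}
    {s : ℝ} (hs : 0 ≤ s) {f g : α → ℝ} (hf : AEStronglyMeasurable f μ)
    (hg : AEStronglyMeasurable g μ) :
    AEStronglyMeasurable (fun x => monoForm d s (f x) (g x)) μ :=
  (continuous_monoForm (d := d) hs).comp_aestronglyMeasurable (f := fun x => (f x, g x))
    (hf.prodMk hg)

/-- The normalized nonlocal integrand, in the variables `(x, y)`. -/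
def pairForm {d : ℕ} (s : ℝ) (u v : Euc d → ℝ) (p : Euc d × Euc d) : ℝ :=
  kappa d s (p.1 - p.2) * monoForm d s (diffQuot u p.1 p.2) (diffQuot v p.1 p.2)

/-- The weight `1 + 1_{Ω^c}` that accounts for the pairs in `Ω^c × Ω` after symmetrization. -/
def boundaryWeight {d : ℕ} (Ω : Set (Euc d)) (y : Euc d) : ℝ := 1 + Ωᶜ.indicator 1 y

/-- The symmetrized nonlocal integrand with increment `h` at the point `x ∈ Ω`. -/
def shiftForm {d : ℕ} (s : ℝ) (Ω : Set (Euc d)) (u v : Euc d → ℝ) (h : Euc d) : Euc d → ℝ :=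
  Ω.indicator fun x => boundaryWeight Ω (x + h) * monoForm d s (incQuot u h x) (incQuot v h x)

lemma one_le_boundaryWeight {d : ℕ} (Ω : Set (Euc d)) (y : Euc d) : 1 ≤ boundaryWeight Ω y := by
  unfold boundaryWeight
  linarith [indicator_nonneg (s := Ωᶜ) (f := (1 : Euc d → ℝ)) (fun _ _ => zero_le_one) y]

lemma boundaryWeight_le_two {d : ℕ} (Ω : Set (Euc d)) (y : Euc d) : boundaryWeight Ω y ≤ 2 := by
  unfold boundaryWeight
  linarith [indicator_le_self' (s := Ωᶜ) (f := (1 : Euc d → ℝ)) (fun _ _ => zero_le_one) y,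
    Pi.one_apply (M := fun _ : Euc d => ℝ) y]

lemma measurable_boundaryWeight {d : ℕ} {Ω : Set (Euc d)} (hΩ : MeasurableSet Ω) :
    Measurable (boundaryWeight Ω) :=
  (measurable_one.indicator hΩ.compl).const_add 1

lemma shiftForm_nonneg {d : ℕ} (s : ℝ) (Ω : Set (Euc d)) (u v : Euc d → ℝ) (h x : Euc d) :
    0 ≤ shiftForm s Ω u v h x :=
  indicator_nonneg (fun _ _ => mul_nonneg (zero_le_one.trans (one_le_boundaryWeight Ω _))
    (monoForm_nonneg _ _ _ _)) x

lemma shiftForm_le {d : ℕ} {s : ℝ} (hs : 0 ≤ s) (Ω : Set (Euc d)) (u v : Euc d → ℝ)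
    (h x : Euc d) :
    shiftForm s Ω u v h x ≤ 2 * incQuot (fun y => u y - v y) h x ^ 2 := by
  unfold shiftForm
  by_cases hx : x ∈ Ω
  swap
  · rw [indicator_of_notMem hx]
    positivity
  rw [indicator_of_mem hx, incQuot_sub]
  exact mul_le_mul (boundaryWeight_le_two Ω _) (monoForm_le hs _ _) (monoForm_nonneg _ _ _ _)
    zero_le_two

lemma scaling_mul_nonlocalErrorIntegrand {d : ℕ} (s : ℝ) (u v : Euc d → ℝ) (p : Euc d × Euc d) :
    scaling d s * nonlocalErrorIntegrand s u v p = pairForm s u v p := by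
  simp only [nonlocalErrorIntegrand, pairForm, monoForm, kappa, diffQuot, Pi.sub_apply]
  ring

lemma diffQuot_swap {d : ℕ} (u : Euc d → ℝ) (x y : Euc d) : diffQuot u y x = -diffQuot u x y := by
  rw [diffQuot, diffQuot, norm_sub_rev]; ring

lemma pairForm_swap {d : ℕ} (s : ℝ) (u v : Euc d → ℝ) (p : Euc d × Euc d) :
    pairForm s u v p.swap = pairForm s u v p := by
  simp only [pairForm, Prod.fst_swap, Prod.snd_swap]
  rw [diffQuot_swap u, diffQuot_swap v, monoForm_neg, ← neg_sub p.1, kappa_neg]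

lemma pairForm_nonneg {d : ℕ} {s : ℝ} (hs : s ≤ 1 / 2) (u v : Euc d → ℝ) (p : Euc d × Euc d) :
    0 ≤ pairForm s u v p := mul_nonneg (kappa_nonneg hs _) (monoForm_nonneg _ _ _ _)

lemma pairForm_add {d : ℕ} (s : ℝ) (u v : Euc d → ℝ) (x h : Euc d) :
    pairForm s u v (x, x + h) = kappa d s h * monoForm d s (incQuot u h x) (incQuot v h x) := by
  have e : ∀ w : Euc d → ℝ, diffQuot w x (x + h) = -incQuot w h x := fun w => by
    rw [diffQuot, incQuot, sub_add_cancel_left, norm_neg]; ring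
  rw [pairForm, e, e, monoForm_neg, sub_add_cancel_left, kappa_neg]

lemma aestronglyMeasurable_diffQuot {d : ℕ} {u : Euc d → ℝ} (hu : AEStronglyMeasurable u volume) :
    AEStronglyMeasurable (fun p : Euc d × Euc d => diffQuot u p.1 p.2) (volume.prod volume) := by
  have h1 : AEMeasurable (fun p : Euc d × Euc d => ‖p.1 - p.2‖) (volume.prod volume) := by fun_prop
  exact ((hu.comp_fst (ν := volume)).sub (hu.comp_snd (μ := volume))).aemeasurable.div h1
    |>.aestronglyMeasurable

lemma aestronglyMeasurable_pairForm {d : ℕ} {s : ℝ} (hs : 0 ≤ s) {u v : Euc d → ℝ}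
    (hu : AEStronglyMeasurable u volume) (hv : AEStronglyMeasurable v volume) :
    AEStronglyMeasurable (pairForm s u v) (volume.prod volume) := by
  refine AEStronglyMeasurable.mul (Measurable.aestronglyMeasurable (by fun_prop)) ?_
  exact aestronglyMeasurable_monoForm hs (aestronglyMeasurable_diffQuot hu)
    (aestronglyMeasurable_diffQuot hv)

lemma integral_sq_eq_toReal_sq {α F : Type*} [MeasurableSpace α] [NormedAddCommGroup F]
    {μ : Measure α} {f : α → F} (hf : AEStronglyMeasurable f μ) :
    ∫ x, ‖f x‖ ^ 2 ∂μ = (eLpNorm f 2 μ).toReal ^ 2 := by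
  rw [← ENNReal.toReal_pow, eLpNorm_two_sq, integral_eq_lintegral_of_nonneg_ae
    (Eventually.of_forall fun _ => by positivity) (by fun_prop)]
  congr 1
  refine lintegral_congr fun x => ?_
  rw [ENNReal.ofReal_pow (norm_nonneg _), ofReal_norm]

section Increments

variable {d : ℕ} {u v : Euc d → ℝ} {a b : Euc d → Euc d}

lemma HasStrongGradient.memLp_incQuot (hu : HasStrongGradient u a) {h : Euc d} (hh : h ≠ 0) :
    MemLp (incQuot u h) 2 volume :=
  ⟨aestronglyMeasurable_incQuot hu.1.1 h, (hu.eLpNorm_incQuot_le hh).trans_lt hu.2.1.2⟩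

lemma HasStrongGradient.integral_incQuot_sq_le (hu : HasStrongGradient u a) {h : Euc d}
    (hh : h ≠ 0) : ∫ x, incQuot u h x ^ 2 ≤ (eLpNorm a 2 volume).toReal ^ 2 := by
  have := integral_sq_eq_toReal_sq (hu.memLp_incQuot hh).1
  simp only [Real.norm_eq_abs, sq_abs] at this
  rw [this]
  gcongr
  exacts [hu.2.1.2.ne, hu.eLpNorm_incQuot_le hh]

lemma HasStrongGradient.integral_incQuot_sq_le' (hu : HasStrongGradient u a) {h : Euc d}
    (hh : h ≠ 0) :
    ∫ x, incQuot u h x ^ 2 ≤ 4 * (eLpNorm u 2 volume).toReal ^ 2 / ‖h‖ ^ 2 := by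
  have := integral_sq_eq_toReal_sq (hu.memLp_incQuot hh).1
  simp only [Real.norm_eq_abs, sq_abs] at this
  rw [this]
  have h1 := ENNReal.toReal_mono (ENNReal.mul_ne_top (by simpa using hh)
    (ENNReal.mul_ne_top (by simp) hu.1.2.ne)) (eLpNorm_incQuot_le_of_memLp hu.1.1 hh)
  rw [ENNReal.toReal_mul, ENNReal.toReal_inv, ENNReal.toReal_mul, toReal_enorm] at h1
  calc _ ≤ (‖h‖⁻¹ * (ENNReal.toReal 2 * (eLpNorm u 2 volume).toReal)) ^ 2 := by gcongr
    _ = _ := by simp; ring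

lemma integrable_shiftForm {s : ℝ} (hs : 0 ≤ s) {Ω : Set (Euc d)} (hΩ : MeasurableSet Ω)
    (hu : HasStrongGradient u a) (hv : HasStrongGradient v b) {h : Euc d} (hh : h ≠ 0) :
    Integrable (shiftForm s Ω u v h) := by
  refine Integrable.mono' (((hu.sub hv).memLp_incQuot hh).integrable_sq.const_mul 2) ?_
    (Eventually.of_forall fun x => ?_)
  · refine AEStronglyMeasurable.indicator (AEStronglyMeasurable.mul ?_ ?_) hΩ
    · exact ((measurable_boundaryWeight hΩ).comp (measurable_add_const h)).aestronglyMeasurable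
    · exact aestronglyMeasurable_monoForm hs (aestronglyMeasurable_incQuot hu.1.1 h)
        (aestronglyMeasurable_incQuot hv.1.1 h)
  · rw [Real.norm_of_nonneg (shiftForm_nonneg ..)]
    exact shiftForm_le hs Ω u v h x

lemma integral_shiftForm_nonneg (s : ℝ) (Ω : Set (Euc d)) (u v : Euc d → ℝ) (h : Euc d) :
    0 ≤ ∫ x, shiftForm s Ω u v h x := integral_nonneg fun x => shiftForm_nonneg s Ω u v h x

lemma integral_shiftForm_le_two_mul {s : ℝ} (hs : 0 ≤ s) {Ω : Set (Euc d)} (hΩ : MeasurableSet Ω)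
    (hu : HasStrongGradient u a) (hv : HasStrongGradient v b) {h : Euc d} (hh : h ≠ 0) :
    ∫ x, shiftForm s Ω u v h x ≤ 2 * ∫ x, incQuot (fun y => u y - v y) h x ^ 2 := by
  rw [← integral_const_mul]
  exact integral_mono (integrable_shiftForm hs hΩ hu hv hh)
    (((hu.sub hv).memLp_incQuot hh).integrable_sq.const_mul 2) (shiftForm_le hs Ω u v h)

/-- An integrable majorant of `κ_s(h) ∫ shiftForm`. -/
def kappaMajorant (d : ℕ) (s A B : ℝ) (h : Euc d) : ℝ :=
  (Metric.ball 0 1).indicator (fun h => kappa d s h * (2 * A)) h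
    + 8 * B * (scaling d s * (2 ^ ((d : ℝ) + 1) * (1 + ‖h‖) ^ (-((d : ℝ) + 1))))

lemma integrable_kappaMajorant (hd : 1 ≤ d) {s : ℝ} (hs : s < 1 / 2) (A B : ℝ) :
    Integrable (kappaMajorant d s A B) := by
  refine Integrable.add ?_ ?_
  · exact (integrable_indicator_iff measurableSet_ball).2
      ((integrableOn_ball_kappa hd hs).mul_const _)
  · exact (((integrable_one_add_norm (by simp)).const_mul _).const_mul _).const_mul _

lemma kappa_mul_integral_shiftForm_le_of_one_le {s : ℝ} (hs : 0 < s)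
    (hs' : s < 1 / 2) {Ω : Set (Euc d)} (hΩ : MeasurableSet Ω)
    (hu : HasStrongGradient u a) (hv : HasStrongGradient v b) {h : Euc d} (hh : 1 ≤ ‖h‖) :
    kappa d s h * ∫ x, shiftForm s Ω u v h x
      ≤ 8 * (eLpNorm (fun x => u x - v x) 2 volume).toReal ^ 2 *
        (scaling d s * (2 ^ ((d : ℝ) + 1) * (1 + ‖h‖) ^ (-((d : ℝ) + 1)))) := by
  have hh0 : h ≠ 0 := norm_pos_iff.1 (by linarith)
  have hk := kappa_nonneg hs'.le h
  have h1 := (integral_shiftForm_le_two_mul hs.le hΩ hu hv hh0).trans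
    (mul_le_mul_of_nonneg_left ((hu.sub hv).integral_incQuot_sq_le' hh0) zero_le_two)
  calc _ ≤ kappa d s h * (2 * (4 * (eLpNorm (fun x => u x - v x) 2 volume).toReal ^ 2 / ‖h‖ ^ 2)) :=
        mul_le_mul_of_nonneg_left h1 hk
    _ = 8 * (eLpNorm (fun x => u x - v x) 2 volume).toReal ^ 2 * (kappa d s h / ‖h‖ ^ 2) := by ring
    _ ≤ _ := mul_le_mul_of_nonneg_left (kappa_div_norm_sq_le hs hs'.le hh) (by positivity)

lemma kappa_mul_integral_shiftForm_le {s : ℝ} (hs : 0 < s)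
    (hs' : s < 1 / 2) {Ω : Set (Euc d)} (hΩ : MeasurableSet Ω)
    (hu : HasStrongGradient u a) (hv : HasStrongGradient v b) {h : Euc d} (hh : h ≠ 0) :
    kappa d s h * ∫ x, shiftForm s Ω u v h x
      ≤ kappaMajorant d s ((eLpNorm (fun x => a x - b x) 2 volume).toReal ^ 2)
        ((eLpNorm (fun x => u x - v x) 2 volume).toReal ^ 2) h := by
  have hC := scaling_nonneg (d := d) hs'.le
  unfold kappaMajorant
  by_cases h1 : h ∈ Metric.ball (0 : Euc d) 1
  · rw [indicator_of_mem h1]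
    have h2 := (integral_shiftForm_le_two_mul hs.le hΩ hu hv hh).trans
      (mul_le_mul_of_nonneg_left ((hu.sub hv).integral_incQuot_sq_le hh) zero_le_two)
    have h3 := mul_le_mul_of_nonneg_left h2 (kappa_nonneg hs'.le h)
    have h4 : 0 ≤ 8 * (eLpNorm (fun x => u x - v x) 2 volume).toReal ^ 2 *
        (scaling d s * (2 ^ ((d : ℝ) + 1) * (1 + ‖h‖) ^ (-((d : ℝ) + 1)))) := by positivity
    linarith
  · rw [indicator_of_notMem h1, zero_add]
    exact kappa_mul_integral_shiftForm_le_of_one_le hs hs' hΩ hu hv (by simpa using h1)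

/-- The symmetrized integrand on `Ω × ℝ^d`, in the variables `(x, y)`. -/
def symPairForm (s : ℝ) (Ω : Set (Euc d)) (u v : Euc d → ℝ) : Euc d × Euc d → ℝ :=
  (Ω ×ˢ univ).indicator fun p => boundaryWeight Ω p.2 * pairForm s u v p

lemma symPairForm_shear (s : ℝ) (Ω : Set (Euc d)) (u v : Euc d → ℝ) (z : Euc d × Euc d) :
    symPairForm s Ω u v (z.2, z.2 + z.1) = kappa d s z.1 * shiftForm s Ω u v z.1 z.2 := by
  by_cases hz : z.2 ∈ Ω
  · rw [symPairForm, shiftForm, indicator_of_mem (by simpa using hz), indicator_of_mem hz,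
      pairForm_add]
    ring
  · rw [symPairForm, shiftForm, indicator_of_notMem (by simpa using hz), indicator_of_notMem hz,
      mul_zero]

lemma aestronglyMeasurable_symPairForm {s : ℝ} (hs : 0 ≤ s) {Ω : Set (Euc d)}
    (hΩ : MeasurableSet Ω) (hu : AEStronglyMeasurable u volume)
    (hv : AEStronglyMeasurable v volume) :
    AEStronglyMeasurable (symPairForm s Ω u v) (volume.prod volume) :=
  (((measurable_boundaryWeight hΩ).comp measurable_snd).aestronglyMeasurable.mul
    (aestronglyMeasurable_pairForm hs hu hv)).indicator (hΩ.prod MeasurableSet.univ)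

/-- Integrate in `x` first: the gradient bound for `‖h‖ < 1` and the `L²` bound for `‖h‖ ≥ 1`
combine into `kappaMajorant`, which is integrable in `h`. -/
lemma integrable_kappa_mul_shiftForm (hd : 1 ≤ d) {s : ℝ} (hs : 0 < s) (hs' : s < 1 / 2)
    {Ω : Set (Euc d)} (hΩ : MeasurableSet Ω)
    (hu : HasStrongGradient u a) (hv : HasStrongGradient v b) :
    Integrable (fun z : Euc d × Euc d => kappa d s z.1 * shiftForm s Ω u v z.1 z.2)
      (volume.prod volume) := by
  have : Nonempty (Fin d) := ⟨⟨0, hd⟩⟩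
  have hm : AEStronglyMeasurable
      (fun z : Euc d × Euc d => kappa d s z.1 * shiftForm s Ω u v z.1 z.2)
      (volume.prod volume) := by
    simp only [← symPairForm_shear]
    exact (aestronglyMeasurable_symPairForm hs.le hΩ hu.1.1 hv.1.1).comp_measurePreserving
      (measurePreserving_prod_add_swap volume volume)
  have hne : ∀ᵐ h : Euc d, h ≠ 0 := compl_mem_ae_iff.2 (measure_singleton 0)
  rw [integrable_prod_iff hm]
  refine ⟨?_, ?_⟩
  · filter_upwards [hne] with h hh
    exact (integrable_shiftForm hs.le hΩ hu hv hh).const_mul _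
  · refine Integrable.mono' (integrable_kappaMajorant hd hs'
      ((eLpNorm (fun x => a x - b x) 2 volume).toReal ^ 2)
      ((eLpNorm (fun x => u x - v x) 2 volume).toReal ^ 2)) hm.norm.integral_prod_right' ?_
    filter_upwards [hne] with h hh
    have e : ∀ x, ‖kappa d s h * shiftForm s Ω u v h x‖ = kappa d s h * shiftForm s Ω u v h x :=
      fun x => Real.norm_of_nonneg (mul_nonneg (kappa_nonneg hs'.le h) (shiftForm_nonneg ..))
    simp only [e]
    rw [integral_const_mul, Real.norm_of_nonneg (mul_nonneg (kappa_nonneg hs'.le h)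
      (integral_shiftForm_nonneg ..))]
    exact kappa_mul_integral_shiftForm_le hs hs' hΩ hu hv hh

lemma integrable_symPairForm (hd : 1 ≤ d) {s : ℝ} (hs : 0 < s) (hs' : s < 1 / 2)
    {Ω : Set (Euc d)} (hΩ : MeasurableSet Ω)
    (hu : HasStrongGradient u a) (hv : HasStrongGradient v b) :
    Integrable (symPairForm s Ω u v) (volume.prod volume) := by
  have h := integrable_kappa_mul_shiftForm hd hs hs' hΩ hu hv
  simp only [← symPairForm_shear] at h
  exact ((measurePreserving_prod_add_swap volume volume).integrable_comp
    (aestronglyMeasurable_symPairForm hs.le hΩ hu.1.1 hv.1.1)).1 h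

lemma integral_symPairForm (hd : 1 ≤ d) {s : ℝ} (hs : 0 < s) (hs' : s < 1 / 2)
    {Ω : Set (Euc d)} (hΩ : MeasurableSet Ω)
    (hu : HasStrongGradient u a) (hv : HasStrongGradient v b) :
    ∫ p, symPairForm s Ω u v p ∂(volume.prod volume)
      = ∫ h, kappa d s h * ∫ x, shiftForm s Ω u v h x := by
  have hT := measurePreserving_prod_add_swap (volume : Measure (Euc d)) (volume : Measure (Euc d))
  have hm := aestronglyMeasurable_symPairForm (s := s) hs.le hΩ hu.1.1 hv.1.1
  -- The product measure is its own image under the shear `(h, x) ↦ (x, x + h)`.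
  rw [← hT.map_eq] at hm ⊢
  rw [integral_map hT.measurable.aemeasurable hm]
  simp only [symPairForm_shear]
  rw [integral_prod _ (integrable_kappa_mul_shiftForm hd hs hs' hΩ hu hv)]
  simp only [integral_const_mul]

lemma interactionSet_eq (Ω : Set (Euc d)) : interactionSet Ω = Ω ×ˢ univ ∪ Ωᶜ ×ˢ Ω := by
  ext p
  simp only [interactionSet, mem_compl_iff, mem_prod, mem_union, mem_univ, and_true]
  tauto

lemma integrableOn_pairForm_prod_univ (hd : 1 ≤ d) {s : ℝ} (hs : 0 < s) (hs' : s < 1 / 2)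
    {Ω : Set (Euc d)} (hΩ : MeasurableSet Ω)
    (hu : HasStrongGradient u a) (hv : HasStrongGradient v b) :
    IntegrableOn (pairForm s u v) (Ω ×ˢ univ) (volume.prod volume) := by
  have h := (integrable_indicator_iff (hΩ.prod MeasurableSet.univ)).1
    (integrable_symPairForm hd hs hs' hΩ hu hv)
  refine Integrable.mono' h (aestronglyMeasurable_pairForm hs.le hu.1.1 hv.1.1).restrict
    (Eventually.of_forall fun p => ?_)
  rw [Real.norm_of_nonneg (pairForm_nonneg hs'.le u v p)]
  exact le_mul_of_one_le_left (pairForm_nonneg hs'.le u v p) (one_le_boundaryWeight Ω _)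

lemma integrableOn_pairForm_compl_prod (hd : 1 ≤ d) {s : ℝ} (hs : 0 < s) (hs' : s < 1 / 2)
    {Ω : Set (Euc d)} (hΩ : MeasurableSet Ω)
    (hu : HasStrongGradient u a) (hv : HasStrongGradient v b) :
    IntegrableOn (pairForm s u v) (Ωᶜ ×ˢ Ω) (volume.prod volume) := by
  have h := (integrableOn_pairForm_prod_univ hd hs hs' hΩ hu hv).mono_set
    (prod_mono_right (subset_univ Ωᶜ))
  rw [← Measure.measurePreserving_swap.integrableOn_comp_preimage
    MeasurableEquiv.prodComm.measurableEmbedding, preimage_swap_prod] at h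
  exact h.congr_fun (fun p _ => pairForm_swap s u v p) (hΩ.compl.prod hΩ)

/-- Swapping the variables carries `Ωᶜ ×ˢ Ω` to `Ω ×ˢ Ωᶜ` and leaves the integrand unchanged. Pairs
with only one point in `Ω` thus count twice on `Ω ×ˢ univ`, which is what `boundaryWeight` records.
-/
lemma setIntegral_interactionSet_pairForm (hd : 1 ≤ d) {s : ℝ} (hs : 0 < s) (hs' : s < 1 / 2)
    {Ω : Set (Euc d)} (hΩ : MeasurableSet Ω)
    (hu : HasStrongGradient u a) (hv : HasStrongGradient v b) :
    ∫ p in interactionSet Ω, pairForm s u v p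
      = ∫ h, kappa d s h * ∫ x, shiftForm s Ω u v h x := by
  have h1 := integrableOn_pairForm_prod_univ hd hs hs' hΩ hu hv
  have h2 := integrableOn_pairForm_compl_prod hd hs hs' hΩ hu hv
  have hswap := Measure.measurePreserving_swap.setIntegral_preimage_emb
    (MeasurableEquiv.prodComm.measurableEmbedding) (pairForm s u v) (Ω ×ˢ Ωᶜ)
    (μ := (volume : Measure (Euc d)).prod (volume : Measure (Euc d)))
  rw [preimage_swap_prod] at hswap
  simp only [pairForm_swap] at hswap
  rw [← integral_symPairForm hd hs hs' hΩ hu hv, interactionSet_eq, Measure.volume_eq_prod,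
    setIntegral_union (disjoint_left.2 fun p hp hp' => hp'.1 hp.1) (hΩ.compl.prod hΩ) h1 h2, hswap,
    symPairForm, integral_indicator (hΩ.prod MeasurableSet.univ)]
  have e : ∀ p : Euc d × Euc d, boundaryWeight Ω p.2 * pairForm s u v p
      = pairForm s u v p + (univ ×ˢ Ωᶜ).indicator (pairForm s u v) p := by
    intro p
    by_cases hp : p.2 ∈ Ω
    · rw [indicator_of_notMem (by simpa using hp), boundaryWeight, indicator_of_notMem (by simpa)]
      ring
    · rw [indicator_of_mem (by simpa using hp), boundaryWeight, indicator_of_mem hp, Pi.one_apply]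
      ring
  simp only [e]
  have hm : MeasurableSet ((univ : Set (Euc d)) ×ˢ Ωᶜ) := MeasurableSet.univ.prod hΩ.compl
  rw [integral_add h1 (Integrable.indicator h1 hm), setIntegral_indicator hm, prod_inter_prod,
    inter_univ, univ_inter]

lemma integrableOn_nonlocalErrorIntegrand (hd : 1 ≤ d) {s : ℝ} (hs : 0 < s) (hs' : s < 1 / 2)
    {Ω : Set (Euc d)} (hΩ : MeasurableSet Ω)
    (hu : HasStrongGradient u a) (hv : HasStrongGradient v b) :
    IntegrableOn (nonlocalErrorIntegrand s u v) (interactionSet Ω) := by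
  have h1 := (integrableOn_pairForm_prod_univ hd hs hs' hΩ hu hv).union
    (integrableOn_pairForm_compl_prod hd hs hs' hΩ hu hv)
  rw [← interactionSet_eq] at h1
  have hC : scaling d s ≠ 0 :=
    div_ne_zero (by linarith) (ballVolume_pos d).ne'
  have h2 : IntegrableOn (fun p => (scaling d s)⁻¹ * pairForm s u v p) (interactionSet Ω) :=
    Integrable.const_mul h1 _
  simpa only [← scaling_mul_nonlocalErrorIntegrand, inv_mul_cancel_left₀ hC] using h2

end Increments

/-! ### Comparison with the directional form for small increments -/

section Limit

variable {d : ℕ} {u v : Euc d → ℝ} {a b : Euc d → Euc d}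

/-- The form in the directional derivatives along `h`, the limit of the form in the difference
quotients. -/
def directionalForm (a b : Euc d → Euc d) (h x : Euc d) : ℝ :=
  monoForm d (1 / 2) (inner ℝ (a x) (‖h‖⁻¹ • h)) (inner ℝ (b x) (‖h‖⁻¹ • h))

lemma directionalForm_nonneg (a b : Euc d → Euc d) (h x : Euc d) :
    0 ≤ directionalForm a b h x := monoForm_nonneg _ _ _ _

lemma sq_inner_direction_le (c h : Euc d) : inner ℝ c (‖h‖⁻¹ • h) ^ 2 ≤ ‖c‖ ^ 2 := by
  rw [← sq_abs]
  exact pow_le_pow_left₀ (abs_nonneg _) (abs_inner_direction_le c h) 2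

lemma directionalForm_le (a b : Euc d → Euc d) (h x : Euc d) :
    directionalForm a b h x ≤ ‖a x - b x‖ ^ 2 := by
  refine (monoForm_le (by norm_num) _ _).trans ?_
  rw [← inner_sub_left]
  exact sq_inner_direction_le _ h

lemma aestronglyMeasurable_inner_direction {μ : Measure (Euc d)} (ha : AEStronglyMeasurable a μ)
    (h : Euc d) : AEStronglyMeasurable (fun x => inner ℝ (a x) (‖h‖⁻¹ • h)) μ :=
  ha.inner (𝕜 := ℝ) aestronglyMeasurable_const

lemma integrable_norm_sub_sq (ha : MemLp a 2 volume) (hb : MemLp b 2 volume) :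
    Integrable fun x => ‖a x - b x‖ ^ 2 :=
  (memLp_two_iff_integrable_sq_norm (ha.sub hb).1).1 (ha.sub hb)

lemma integrable_directionalForm (ha : MemLp a 2 volume) (hb : MemLp b 2 volume) (h : Euc d) :
    Integrable (directionalForm a b h) := by
  refine Integrable.mono' (integrable_norm_sub_sq ha hb) ?_ (Eventually.of_forall fun x => ?_)
  · exact aestronglyMeasurable_monoForm (by norm_num)
      (aestronglyMeasurable_inner_direction ha.1 h) (aestronglyMeasurable_inner_direction hb.1 h)
  · rw [Real.norm_of_nonneg (directionalForm_nonneg ..)]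
    exact directionalForm_le a b h x

lemma integrable_kappa_mul_directionalForm (hd : 1 ≤ d) {s : ℝ} (hs : s < 1 / 2)
    (ha : MemLp a 2 volume) (hb : MemLp b 2 volume) (Ω : Set (Euc d)) :
    Integrable (fun z : Euc d × Euc d => kappa d s z.1 * directionalForm a b z.1 z.2)
      ((volume.restrict (Metric.ball 0 1)).prod (volume.restrict Ω)) := by
  have h1 : Integrable (fun x => ‖a x - b x‖ ^ 2) (volume.restrict Ω) :=
    (integrable_norm_sub_sq ha hb).restrict
  have hk := integrableOn_ball_kappa hd hs
  have hdir : ∀ c : Euc d → Euc d, MemLp c 2 volume → AEStronglyMeasurable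
      (fun z : Euc d × Euc d => inner ℝ (c z.2) (‖z.1‖⁻¹ • z.1))
      ((volume.restrict (Metric.ball 0 1)).prod (volume.restrict Ω)) := fun c hc =>
    (hc.1.restrict.comp_snd).inner (𝕜 := ℝ) (Measurable.aestronglyMeasurable (by fun_prop))
  refine Integrable.mono' (hk.mul_prod h1) ?_ (Eventually.of_forall fun z => ?_)
  · exact AEStronglyMeasurable.mul (Measurable.aestronglyMeasurable (by fun_prop))
      (aestronglyMeasurable_monoForm (by norm_num) (hdir a ha) (hdir b hb))
  · rw [Real.norm_of_nonneg (mul_nonneg (kappa_nonneg hs.le _) (directionalForm_nonneg ..))]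
    exact mul_le_mul_of_nonneg_left (directionalForm_le ..) (kappa_nonneg hs.le _)

/-- The local geometric form of two gradients. -/
def normalForm (p q : Euc d) : ℝ :=
  ‖unitNormal p - unitNormal q‖ ^ 2 * ((areaElement p + areaElement q) / 2)

lemma integrableOn_normalForm (hd : 1 ≤ d) (ha : MemLp a 2 volume) (hb : MemLp b 2 volume)
    (Ω : Set (Euc d)) : IntegrableOn (fun x => normalForm (a x) (b x)) Ω := by
  -- Any `s < 1/2` would do here, since the average over directions does not depend on `s`.
  have h := (integrable_kappa_mul_directionalForm hd (s := 0) (by norm_num) ha hb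
    Ω).integral_prod_right
  simp only [directionalForm, integral_ball_kappa_mul_monoForm hd (s := 0) (by norm_num)] at h
  exact h

lemma integral_ball_kappa_mul_directionalForm (hd : 1 ≤ d) {s : ℝ} (hs : s < 1 / 2)
    (ha : MemLp a 2 volume) (hb : MemLp b 2 volume) (Ω : Set (Euc d)) :
    ∫ h in Metric.ball 0 1, kappa d s h * ∫ x in Ω, directionalForm a b h x
      = ∫ x in Ω, normalForm (a x) (b x) := by
  simp only [← integral_const_mul]
  rw [integral_integral_swap (integrable_kappa_mul_directionalForm hd hs ha hb Ω)]
  simp only [directionalForm, integral_ball_kappa_mul_monoForm hd hs, normalForm]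

lemma integrableOn_kappa_mul_integral_directionalForm (hd : 1 ≤ d) {s : ℝ} (hs : s < 1 / 2)
    (ha : MemLp a 2 volume) (hb : MemLp b 2 volume) (Ω : Set (Euc d)) :
    IntegrableOn (fun h => kappa d s h * ∫ x in Ω, directionalForm a b h x)
      (Metric.ball 0 1) := by
  simp only [← integral_const_mul]
  exact (integrable_kappa_mul_directionalForm hd hs ha hb Ω).integral_prod_left

lemma integral_mul_le_toReal_eLpNorm {α : Type*} [MeasurableSpace α] {μ : Measure α}
    {f g : α → ℝ} (hf : MemLp f 2 μ) (hg : MemLp g 2 μ) :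
    ∫ x, f x * g x ∂μ ≤ (eLpNorm f 2 μ).toReal * (eLpNorm g 2 μ).toReal := by
  have h1 := eLpNorm_smul_le_mul_eLpNorm (p := 2) (q := 2) (r := 1) hg.1 hf.1
  have h2 := ENNReal.toReal_mono (ENNReal.mul_ne_top hf.2.ne hg.2.ne) h1
  rw [ENNReal.toReal_mul, eLpNorm_one_eq_lintegral_enorm,
    ← integral_norm_eq_lintegral_enorm (hf.1.smul hg.1)] at h2
  exact ((le_abs_self _).trans (norm_integral_le_integral_norm fun x => f x * g x)).trans h2

lemma toReal_eLpNorm_abs_add_abs_le {α : Type*} [MeasurableSpace α] {μ : Measure α}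
    {f g : α → ℝ} (hf : MemLp f 2 μ) (hg : MemLp g 2 μ) :
    (eLpNorm (fun x => |f x| + |g x|) 2 μ).toReal
      ≤ (eLpNorm f 2 μ).toReal + (eLpNorm g 2 μ).toReal := by
  rw [← ENNReal.toReal_add hf.2.ne hg.2.ne]
  refine ENNReal.toReal_mono (ENNReal.add_ne_top.2 ⟨hf.2.ne, hg.2.ne⟩)
    ((eLpNorm_add_le (f := fun x => |f x|) (g := fun x => |g x|) hf.abs.1 hg.abs.1
      (by norm_num)).trans ?_)
  exact add_le_add (eLpNorm_mono fun x => by simp) (eLpNorm_mono fun x => by simp)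

/-- The `L²` distance between the difference quotient and the directional derivative. -/
def quotError (u : Euc d → ℝ) (a : Euc d → Euc d) (h : Euc d) : ℝ :=
  (eLpNorm (fun x => incQuot u h x - inner ℝ (a x) (‖h‖⁻¹ • h)) 2 volume).toReal

lemma HasStrongGradient.tendsto_quotError (hu : HasStrongGradient u a) :
    Tendsto (quotError u a) (𝓝[≠] 0) (𝓝 0) := by
  exact (ENNReal.tendsto_toReal ENNReal.zero_ne_top).comp hu.tendsto_incQuot

/-- The energy of `c` at the points of `Ω` that leave `Ω` under the translation by `h`. -/
def exitEnergy (Ω : Set (Euc d)) (c : Euc d → Euc d) (h : Euc d) : ℝ :=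
  ∫ x in Ω, Ωᶜ.indicator 1 (x + h) * ‖c x‖ ^ 2

/-- Dominated convergence: each `x` in the open set `Ω` has `x + h ∈ Ω` for small `h`, so the
indicator eventually vanishes pointwise. -/
lemma tendsto_exitEnergy {Ω : Set (Euc d)} (hΩ : IsOpen Ω) {c : Euc d → Euc d}
    (hc : MemLp c 2 volume) : Tendsto (exitEnergy Ω c) (𝓝 0) (𝓝 0) := by
  have h0 : ∫ _ in Ω, (0 : ℝ) = 0 := by simp
  rw [← h0]
  have hci : Integrable (fun x => ‖c x‖ ^ 2) (volume.restrict Ω) :=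
    ((memLp_two_iff_integrable_sq_norm hc.1).1 hc).restrict
  refine tendsto_integral_filter_of_dominated_convergence (fun x => ‖c x‖ ^ 2)
    (Eventually.of_forall fun h => ?_) (Eventually.of_forall fun h =>
      Eventually.of_forall fun x => ?_) hci ?_
  · exact ((measurable_one.indicator hΩ.measurableSet.compl).comp
      (measurable_add_const h)).aestronglyMeasurable.mul hci.1
  · rw [norm_mul, norm_pow, norm_norm]
    refine mul_le_of_le_one_left (by positivity) ?_
    by_cases hx : x + h ∈ Ωᶜ
    · simp [indicator_of_mem hx]
    · simp [indicator_of_notMem hx]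
  · filter_upwards [ae_restrict_mem hΩ.measurableSet] with x hx
    have hcont : Tendsto (fun h : Euc d => x + h) (𝓝 0) (𝓝 x) := by
      simpa using (continuous_const_add x).tendsto 0
    refine tendsto_const_nhds.congr' ?_
    filter_upwards [hcont.eventually (hΩ.mem_nhds hx)] with h hh
    rw [indicator_of_notMem (notMem_compl_iff.2 hh), zero_mul]

/-- The bound for the difference between the form in the difference quotients and the form in the
directional derivatives. -/
def formError (Ω : Set (Euc d)) (u v : Euc d → ℝ) (a b : Euc d → Euc d) (h : Euc d) : ℝ :=
  (quotError u a h + quotError v b h) * (2 * (eLpNorm (fun x => a x - b x) 2 volume).toReal)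
    + (2 * quotError (fun x => u x - v x) (fun x => a x - b x) h ^ 2
    + 2 * exitEnergy Ω (fun x => a x - b x) h)

lemma tendsto_formError {Ω : Set (Euc d)} (hΩ : IsOpen Ω) (hu : HasStrongGradient u a)
    (hv : HasStrongGradient v b) : Tendsto (formError Ω u v a b) (𝓝[≠] 0) (𝓝 0) := by
  have h1 := hu.tendsto_quotError
  have h2 := hv.tendsto_quotError
  have h3 := (hu.sub hv).tendsto_quotError
  have h4 := (tendsto_exitEnergy hΩ (hu.sub hv).2.1).mono_left
    (nhdsWithin_le_nhds (s := {0}ᶜ))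
  have := ((h1.add h2).mul_const (2 * (eLpNorm (fun x => a x - b x) 2 volume).toReal)).add
    (((h3.pow 2).const_mul 2).add (h4.const_mul 2))
  simp only [add_zero, zero_mul, mul_zero, ne_eq, OfNat.ofNat_ne_zero, not_false_eq_true,
    zero_pow] at this
  exact this

/-- Three errors add up: replacing `s` by `1/2`, replacing quotients by directional derivatives, and
the excess boundary weight. In the last one the quotient of `u - v` is compared with its directional
derivative, which moves the indicator onto the fixed function `‖a - b‖²`, as `exitEnergy` requires.
-/
lemma abs_weighted_monoForm_sub_le {s : ℝ} (hs : 0 ≤ s) (hs' : s ≤ 1 / 2) (Ω : Set (Euc d))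
    (u v : Euc d → ℝ) (a b : Euc d → Euc d) (h x : Euc d) :
    |boundaryWeight Ω (x + h) * monoForm d s (incQuot u h x) (incQuot v h x)
        - directionalForm a b h x|
      ≤ (1 - 2 * s) * (incQuot u h x ^ 2 + incQuot v h x ^ 2)
        + (|incQuot u h x - inner ℝ (a x) (‖h‖⁻¹ • h)| + |incQuot v h x - inner ℝ (b x) (‖h‖⁻¹ • h)|)
          * (|incQuot (fun y => u y - v y) h x| + |inner ℝ (a x - b x) (‖h‖⁻¹ • h)|)
        + (2 * (incQuot (fun y => u y - v y) h x - inner ℝ (a x - b x) (‖h‖⁻¹ • h)) ^ 2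
          + 2 * (Ωᶜ.indicator 1 (x + h) * ‖a x - b x‖ ^ 2)) := by
  rw [incQuot_sub, inner_sub_left]
  have hdir := sq_inner_direction_le (a x - b x) h
  rw [inner_sub_left] at hdir
  set p := incQuot u h x
  set q := incQuot v h x
  set p' := inner ℝ (a x) (‖h‖⁻¹ • h) with hp'
  set q' := inner ℝ (b x) (‖h‖⁻¹ • h) with hq'
  set i : ℝ := Ωᶜ.indicator 1 (x + h) with hi
  have hi01 : 0 ≤ i ∧ i ≤ 1 := by
    have h1 := one_le_boundaryWeight Ω (x + h)
    have h2 := boundaryWeight_le_two Ω (x + h)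
    rw [boundaryWeight, ← hi] at h1 h2
    constructor <;> linarith
  have e : boundaryWeight Ω (x + h) * monoForm d s p q - directionalForm a b h x
      = (monoForm d s p q - monoForm d (1 / 2) p q)
        + (monoForm d (1 / 2) p q - monoForm d (1 / 2) p' q') + i * monoForm d s p q := by
    rw [boundaryWeight, directionalForm, ← hi]; ring
  rw [e]
  refine (abs_add_three _ _ _).trans (add_le_add (add_le_add
    (abs_monoForm_sub_half_le hs hs' p q) (abs_monoForm_sub_le (by norm_num) p q p' q')) ?_)
  have h0 := monoForm_nonneg d s p q
  have h1 := monoForm_le (d := d) hs p q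
  rw [abs_of_nonneg (mul_nonneg hi01.1 h0)]
  have h2 : (p - q) ^ 2 ≤ 2 * (p - q - (p' - q')) ^ 2 + 2 * ‖a x - b x‖ ^ 2 := by
    nlinarith [sq_nonneg (p - q - 2 * (p' - q'))]
  calc i * monoForm d s p q ≤ i * (2 * (p - q - (p' - q')) ^ 2 + 2 * ‖a x - b x‖ ^ 2) :=
        mul_le_mul_of_nonneg_left (h1.trans h2) hi01.1
    _ ≤ _ := by nlinarith [sq_nonneg (p - q - (p' - q'))]

lemma abs_integral_shiftForm_sub_le {s : ℝ} (hs : 0 ≤ s) (hs' : s ≤ 1 / 2) {Ω : Set (Euc d)}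
    (hΩ : MeasurableSet Ω) (hu : HasStrongGradient u a) (hv : HasStrongGradient v b) {h : Euc d}
    (hh : h ≠ 0) :
    |(∫ x, shiftForm s Ω u v h x) - ∫ x in Ω, directionalForm a b h x|
      ≤ (1 - 2 * s) * ((eLpNorm a 2 volume).toReal ^ 2 + (eLpNorm b 2 volume).toReal ^ 2)
        + formError Ω u v a b h := by
  have hw := hu.sub hv
  have mdir : ∀ {c : Euc d → Euc d}, MemLp c 2 volume →
      MemLp (fun x => inner ℝ (c x) (‖h‖⁻¹ • h)) 2 volume := fun hc =>
    ⟨aestronglyMeasurable_inner_direction hc.1 h, (eLpNorm_inner_direction_le _ h).trans_lt hc.2⟩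
  have mu := hu.memLp_incQuot hh
  have mv := hv.memLp_incQuot hh
  have mw := hw.memLp_incQuot hh
  have mδu := mu.sub (mdir hu.2.1)
  have mδv := mv.sub (mdir hv.2.1)
  have mδw := mw.sub (mdir hw.2.1)
  have i1 : Integrable fun x => (1 - 2 * s) * (incQuot u h x ^ 2 + incQuot v h x ^ 2) :=
    (mu.integrable_sq.add mv.integrable_sq).const_mul _
  have mf : MemLp (fun x => |incQuot u h x - inner ℝ (a x) (‖h‖⁻¹ • h)|
      + |incQuot v h x - inner ℝ (b x) (‖h‖⁻¹ • h)|) 2 volume := mδu.abs.add mδv.abs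
  have mg : MemLp (fun x => |incQuot (fun y => u y - v y) h x|
      + |inner ℝ (a x - b x) (‖h‖⁻¹ • h)|) 2 volume := mw.abs.add (mdir hw.2.1).abs
  have i2 := mf.integrable_mul mg
  have i3 : Integrable fun x =>
      2 * (incQuot (fun y => u y - v y) h x - inner ℝ (a x - b x) (‖h‖⁻¹ • h)) ^ 2 :=
    mδw.integrable_sq.const_mul 2
  have hci : Integrable (fun x => ‖a x - b x‖ ^ 2) :=
    integrable_norm_sub_sq hu.2.1 hv.2.1
  have i4 : Integrable fun x => 2 * (Ωᶜ.indicator 1 (x + h) * ‖a x - b x‖ ^ 2) := by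
    refine (hci.bdd_mul (c := 1) ?_ (Eventually.of_forall fun x => ?_)).const_mul 2
    · exact ((measurable_one.indicator hΩ.compl).comp
        (measurable_add_const h)).aestronglyMeasurable
    · by_cases hx : x + h ∈ Ωᶜ
      · simp [indicator_of_mem hx]
      · simp [indicator_of_notMem hx]
  have hS : IntegrableOn (fun x => boundaryWeight Ω (x + h) *
      monoForm d s (incQuot u h x) (incQuot v h x)) Ω :=
    (integrable_indicator_iff hΩ).1 (integrable_shiftForm hs hΩ hu hv hh)
  have e0 : ∫ x, shiftForm s Ω u v h x = ∫ x in Ω, boundaryWeight Ω (x + h) *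
      monoForm d s (incQuot u h x) (incQuot v h x) := by
    unfold shiftForm
    rw [integral_indicator hΩ]
  rw [e0, ← integral_sub hS (integrable_directionalForm hu.2.1 hv.2.1 h).restrict]
  have hb := norm_integral_le_of_norm_le (f := fun x => boundaryWeight Ω (x + h) *
      monoForm d s (incQuot u h x) (incQuot v h x) - directionalForm a b h x) (((i1.add i2).add (i3.add i4)).restrict (s := Ω))
    (Eventually.of_forall fun x => abs_weighted_monoForm_sub_le hs hs' Ω u v a b h x)
  refine hb.trans ?_
  rw [integral_add' (i1.add i2).restrict (i3.add i4).restrict,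
    integral_add' i1.restrict i2.restrict, integral_add' i3.restrict i4.restrict, formError]
  have t1 : ∫ x in Ω, (1 - 2 * s) * (incQuot u h x ^ 2 + incQuot v h x ^ 2)
      ≤ (1 - 2 * s) * ((eLpNorm a 2 volume).toReal ^ 2 + (eLpNorm b 2 volume).toReal ^ 2) := by
    rw [integral_const_mul]
    refine mul_le_mul_of_nonneg_left ?_ (by linarith)
    refine (setIntegral_le_integral (mu.integrable_sq.add mv.integrable_sq)
      (Eventually.of_forall fun x => by
        simp only [Pi.zero_apply, Pi.add_apply]; positivity)).trans ?_
    rw [integral_add' mu.integrable_sq mv.integrable_sq]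
    exact add_le_add (hu.integral_incQuot_sq_le hh) (hv.integral_incQuot_sq_le hh)
  have t2 := (setIntegral_le_integral (s := Ω) i2 (Eventually.of_forall fun x => by
    simp only [Pi.zero_apply, Pi.mul_apply]; positivity)).trans
    (integral_mul_le_toReal_eLpNorm mf mg)
  have t2' := mul_le_mul (toReal_eLpNorm_abs_add_abs_le mδu mδv)
    ((toReal_eLpNorm_abs_add_abs_le mw (mdir hw.2.1)).trans (add_le_add
      (ENNReal.toReal_mono hw.2.1.2.ne (hw.eLpNorm_incQuot_le hh))
      (ENNReal.toReal_mono hw.2.1.2.ne (eLpNorm_inner_direction_le _ h))))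
    ENNReal.toReal_nonneg (add_nonneg ENNReal.toReal_nonneg ENNReal.toReal_nonneg)
  rw [← two_mul] at t2'
  have t3 : ∫ x in Ω, 2 * (incQuot (fun y => u y - v y) h x
        - inner ℝ (a x - b x) (‖h‖⁻¹ • h)) ^ 2
      ≤ 2 * quotError (fun x => u x - v x) (fun x => a x - b x) h ^ 2 := by
    refine (setIntegral_le_integral i3 (Eventually.of_forall fun x => by
      simp only [Pi.zero_apply]; positivity)).trans ?_
    rw [integral_const_mul, quotError]
    have := integral_sq_eq_toReal_sq mδw.1
    simp only [Real.norm_eq_abs, sq_abs] at this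
    exact (congrArg (2 * ·) this).le
  have t4 : ∫ x in Ω, 2 * (Ωᶜ.indicator 1 (x + h) * ‖a x - b x‖ ^ 2)
      = 2 * exitEnergy Ω (fun x => a x - b x) h := by
    rw [integral_const_mul, exitEnergy]
  exact (add_le_add (add_le_add t1 (t2.trans t2')) (add_le_add t3 t4.le)).trans_eq
    (add_assoc _ _ _)

end Limit

/-! ### Concentration of the kernel and passage to the limit -/

section Limit

variable {d : ℕ} {u v : Euc d → ℝ} {a b : Euc d → Euc d}

/-- A crude bound for increments that are not small, where smallness comes from the kernel instead.
The constant is `2` from the boundary weight plus `1` from the directional form. -/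
lemma abs_integral_shiftForm_sub_le_three_mul {s : ℝ} (hs : 0 ≤ s) {Ω : Set (Euc d)}
    (hΩ : MeasurableSet Ω) (hu : HasStrongGradient u a) (hv : HasStrongGradient v b) {h : Euc d}
    (hh : h ≠ 0) :
    |(∫ x, shiftForm s Ω u v h x) - ∫ x in Ω, directionalForm a b h x|
      ≤ 3 * (eLpNorm (fun x => a x - b x) 2 volume).toReal ^ 2 := by
  have h1 := (integral_shiftForm_le_two_mul hs hΩ hu hv hh).trans
    (mul_le_mul_of_nonneg_left ((hu.sub hv).integral_incQuot_sq_le hh) zero_le_two)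
  have h2 : ∫ x in Ω, directionalForm a b h x
      ≤ (eLpNorm (fun x => a x - b x) 2 volume).toReal ^ 2 := by
    rw [← integral_sq_eq_toReal_sq (hu.sub hv).2.1.1]
    refine (setIntegral_le_integral (integrable_directionalForm hu.2.1 hv.2.1 h)
      (Eventually.of_forall fun x => directionalForm_nonneg a b h x)).trans ?_
    exact integral_mono (integrable_directionalForm hu.2.1 hv.2.1 h)
      (integrable_norm_sub_sq hu.2.1 hv.2.1) (directionalForm_le a b h)
  have h3 := integral_shiftForm_nonneg s Ω u v h
  have h4 : 0 ≤ ∫ x in Ω, directionalForm a b h x :=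
    integral_nonneg fun x => directionalForm_nonneg a b h x
  rw [abs_le]
  constructor <;> nlinarith [sq_nonneg (eLpNorm (fun x => a x - b x) 2 volume).toReal]

/-- A quantitative form of the limit: the error is controlled by the supremum `ε` of `formError`
over increments of length less than `δ` and by terms that vanish as `s → 1/2`. -/
lemma abs_integral_kappa_mul_shiftForm_sub_le (hd : 1 ≤ d) {s : ℝ} (hs : 0 < s) (hs' : s < 1 / 2)
    {Ω : Set (Euc d)} (hΩ : MeasurableSet Ω)
    (hu : HasStrongGradient u a) (hv : HasStrongGradient v b) {δ ε : ℝ} (hδ : 0 < δ)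
    (hδ1 : δ ≤ 1) (hε : 0 ≤ ε) (herr : ∀ h : Euc d, h ≠ 0 → ‖h‖ < δ → formError Ω u v a b h ≤ ε) :
    |(∫ h, kappa d s h * ∫ x, shiftForm s Ω u v h x) - ∫ x in Ω, normalForm (a x) (b x)|
      ≤ d * (ε + (1 - 2 * s) *
          ((eLpNorm a 2 volume).toReal ^ 2 + (eLpNorm b 2 volume).toReal ^ 2))
        + volume.real (Metric.ball (0 : Euc d) 1) * (scaling d s / δ ^ d *
          (3 * (eLpNorm (fun x => a x - b x) 2 volume).toReal ^ 2))
        + 8 * (eLpNorm (fun x => u x - v x) 2 volume).toReal ^ 2 * (scaling d s *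
          ∫ h : Euc d, 2 ^ ((d : ℝ) + 1) * (1 + ‖h‖) ^ (-((d : ℝ) + 1))) := by
  have : Nonempty (Fin d) := ⟨⟨0, hd⟩⟩
  have hne : ∀ᵐ h : Euc d, h ≠ 0 := compl_mem_ae_iff.2 (measure_singleton 0)
  set A := (eLpNorm (fun x => a x - b x) 2 volume).toReal ^ 2 with hA
  set C := (eLpNorm a 2 volume).toReal ^ 2 + (eLpNorm b 2 volume).toReal ^ 2 with hC
  have hA0 : 0 ≤ A := by positivity
  have hC0 : 0 ≤ C := by positivity
  have hsc := scaling_nonneg (d := d) hs'.le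
  have hJ : Integrable fun h => kappa d s h * ∫ x, shiftForm s Ω u v h x := by
    have := (integrable_kappa_mul_shiftForm hd hs hs' hΩ hu hv).integral_prod_left
    simpa only [integral_const_mul] using this
  have hK := integrableOn_kappa_mul_integral_directionalForm hd hs' hu.2.1 hv.2.1 Ω
  -- The local form is written as an integral over the unit ball with the same `s`, so there the two
  -- integrands are compared under the same kernel; the complement of the ball is a pure error term.
  rw [← integral_ball_kappa_mul_directionalForm hd hs' hu.2.1 hv.2.1 Ω,
    ← integral_add_compl (measurableSet_ball (x := (0 : Euc d)) (ε := 1)) hJ, add_sub_right_comm,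
    ← integral_sub hJ.integrableOn hK]
  refine (abs_add_le _ _).trans (add_le_add ?_ ?_)
  · have hkint := integrableOn_ball_kappa hd hs'
    have i1 : IntegrableOn (fun h : Euc d => kappa d s h * (ε + (1 - 2 * s) * C))
      (Metric.ball 0 1) := hkint.mul_const _
    have i2 : IntegrableOn (fun _ : Euc d => scaling d s / δ ^ d * (3 * A))
      (Metric.ball 0 1) := integrableOn_const measure_ball_lt_top.ne
    have hb := norm_integral_le_of_norm_le (f := fun h =>
      kappa d s h * (∫ x, shiftForm s Ω u v h x)
        - kappa d s h * ∫ x in Ω, directionalForm a b h x) (i1.add i2)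
      (by
        filter_upwards [ae_restrict_of_ae hne] with h hh
        have hk := kappa_nonneg hs'.le h
        have h3 : 0 ≤ (1 - 2 * s) * C := mul_nonneg (by linarith) hC0
        rw [← mul_sub, norm_mul, Real.norm_of_nonneg hk, Pi.add_apply, Real.norm_eq_abs]
        -- Below `δ` the form error is small against a kernel of mass `d`; above `δ` the form is
        -- merely bounded but the kernel is small. In each case the other nonnegative summand of the
        -- majorant is discarded.
        rcases lt_or_ge ‖h‖ δ with hlt | hge
        · have h1 := abs_integral_shiftForm_sub_le hs.le hs'.le hΩ hu hv hh
          rw [← hC] at h1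
          have h2 := herr h hh hlt
          have h4 : 0 ≤ scaling d s / δ ^ d * (3 * A) := by positivity
          have h5 := mul_le_mul_of_nonneg_left (h1.trans (add_le_add le_rfl h2)) hk
          linarith
        · have h1 := abs_integral_shiftForm_sub_le_three_mul hs.le hΩ hu hv hh
          rw [← hA] at h1
          have h2 := mul_le_mul (kappa_le_of_le_norm hd hs hs'.le hδ hδ1 hge) h1
            (abs_nonneg _) (by positivity)
          have h4 : 0 ≤ kappa d s h * (ε + (1 - 2 * s) * C) := by positivity
          linarith)
    rw [integral_add' i1 i2, integral_mul_const, integral_ball_kappa hd hs', setIntegral_const,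
      smul_eq_mul] at hb
    exact hb
  · have hI : Integrable fun h : Euc d => 2 ^ ((d : ℝ) + 1) * (1 + ‖h‖) ^ (-((d : ℝ) + 1)) :=
      (integrable_one_add_norm (by simp)).const_mul _
    have hI2 := (hI.const_mul (scaling d s)).const_mul
      (8 * (eLpNorm (fun x => u x - v x) 2 volume).toReal ^ 2)
    have hb := norm_integral_le_of_norm_le (μ := volume.restrict (Metric.ball (0 : Euc d) 1)ᶜ)
      (f := fun h => kappa d s h * ∫ x, shiftForm s Ω u v h x) hI2.restrict
      (by
        filter_upwards [ae_restrict_mem measurableSet_ball.compl] with h hh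
        rw [Real.norm_of_nonneg (mul_nonneg (kappa_nonneg hs'.le h)
          (integral_shiftForm_nonneg ..))]
        exact kappa_mul_integral_shiftForm_le_of_one_le hs hs' hΩ hu hv (by simpa using hh))
    refine hb.trans ((setIntegral_le_integral hI2 (Eventually.of_forall fun h => ?_)).trans_eq ?_)
    · simp only [Pi.zero_apply]
      positivity
    · rw [integral_const_mul, integral_const_mul]

lemma tendsto_scaling (d : ℕ) : Tendsto (scaling d) (𝓝 (1 / 2)) (𝓝 0) := by
  have hc : Continuous (scaling d) := by unfold scaling; fun_prop
  have h := hc.tendsto (1 / 2)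
  rwa [show scaling d (1 / 2) = 0 by simp [scaling]] at h

lemma tendsto_integral_kappa_mul_shiftForm (hd : 1 ≤ d) {Ω : Set (Euc d)} (hΩ : IsOpen Ω)
    (hu : HasStrongGradient u a) (hv : HasStrongGradient v b) :
    Tendsto (fun s => ∫ h, kappa d s h * ∫ x, shiftForm s Ω u v h x) (𝓝[<] (1 / 2))
      (𝓝 (∫ x in Ω, normalForm (a x) (b x))) := by
  rw [Metric.tendsto_nhds]
  intro η hη
  -- As `s → 1/2` with `δ` fixed, the bound tends to `d * ε`, which this choice keeps below `η`.
  set ε := η / (d + 1) with hε_def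
  have hε : 0 < ε := by positivity
  obtain ⟨δ₀, hδ₀, hball⟩ := Metric.mem_nhdsWithin_iff.1
    ((tendsto_formError hΩ hu hv).eventually (ge_mem_nhds hε))
  set δ := min δ₀ 1 with hδ_def
  have hδ : 0 < δ := lt_min hδ₀ one_pos
  have herr : ∀ h : Euc d, h ≠ 0 → ‖h‖ < δ → formError Ω u v a b h ≤ ε := fun h hh hlt =>
    hball ⟨by simpa using hlt.trans_le (min_le_left _ _), hh⟩
  have hsc := tendsto_scaling d
  have hlin : Tendsto (fun s : ℝ => 1 - 2 * s) (𝓝 (1 / 2)) (𝓝 0) := by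
    have hc : Continuous fun s : ℝ => 1 - 2 * s := by fun_prop
    simpa using hc.tendsto (1 / 2)
  have hlim := ((((hlin.mul_const ((eLpNorm a 2 volume).toReal ^ 2
      + (eLpNorm b 2 volume).toReal ^ 2)).const_add ε).const_mul (d : ℝ)).add
    (((hsc.div_const (δ ^ d)).mul_const
      (3 * (eLpNorm (fun x => a x - b x) 2 volume).toReal ^ 2)).const_mul
      (volume.real (Metric.ball (0 : Euc d) 1)))).add
    ((hsc.mul_const (∫ h : Euc d, 2 ^ ((d : ℝ) + 1) * (1 + ‖h‖) ^ (-((d : ℝ) + 1)))).const_mul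
      (8 * (eLpNorm (fun x => u x - v x) 2 volume).toReal ^ 2))
  simp only [zero_mul, add_zero, zero_div, mul_zero] at hlim
  have hlt : d * ε < η := by
    rw [hε_def, mul_div_assoc', div_lt_iff₀ (by positivity)]
    nlinarith
  filter_upwards [nhdsWithin_le_nhds (hlim.eventually (gt_mem_nhds hlt)), self_mem_nhdsWithin,
    nhdsWithin_le_nhds (lt_mem_nhds (show (0 : ℝ) < 1 / 2 by norm_num))] with s hs1 hs2 hs3
  rw [Real.dist_eq]
  exact (abs_integral_kappa_mul_shiftForm_sub_le hd hs3 hs2 hΩ.measurableSet hu hv hδ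
    (min_le_right _ _) hε.le herr).trans_lt hs1

end Limit

end NonlocalGraph
end

theorem mainTheorem4 (d : ℕ) (hd : 1 ≤ d)
    (Ω Λ : Set (NonlocalGraph.Euc d))
    (hΩo : IsOpen Ω) (hΛo : IsOpen Λ) (hΛb : Bornology.IsBounded Λ) (hΩΛ : Ω ⊆ Λ)
    (u v : NonlocalGraph.Euc d → ℝ)
    (hu : NonlocalGraph.MemH10 Λ u) (hv : NonlocalGraph.MemH10 Λ v) :
    (∀ s : ℝ, 0 < s → s < 1 / 2 →
      IntegrableOn (NonlocalGraph.nonlocalErrorIntegrand s u v)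
        (NonlocalGraph.interactionSet Ω)) ∧
    IntegrableOn (NonlocalGraph.localErrorIntegrand Ω u v) Ω ∧
    Tendsto (fun s : ℝ => NonlocalGraph.nonlocalError s Ω u v) (𝓝[<] (1 / 2))
      (𝓝 (NonlocalGraph.localError Ω u v)) := by
  obtain ⟨a, hua, ha⟩ := hu.exists_hasStrongGradient hΩo hΛo hΩΛ
  obtain ⟨b, hvb, hb⟩ := hv.exists_hasStrongGradient hΩo hΛo hΩΛ
  have hm := hΩo.measurableSet
  have hae : NonlocalGraph.localErrorIntegrand Ω u v =ᵐ[volume.restrict Ω]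
      fun x => NonlocalGraph.normalForm (a x) (b x) := by
    filter_upwards [ae_restrict_of_ae ha, ae_restrict_of_ae hb, ae_restrict_mem hm]
      with x hxa hxb hx
    rw [NonlocalGraph.localErrorIntegrand, hxa hx, hxb hx, NonlocalGraph.normalForm]
  refine ⟨fun s hs hs' =>
    NonlocalGraph.integrableOn_nonlocalErrorIntegrand hd hs hs' hm hua hvb, ?_, ?_⟩
  · exact (NonlocalGraph.integrableOn_normalForm hd hua.2.1 hvb.2.1 Ω).congr hae.symm
  · have hlim := (NonlocalGraph.tendsto_integral_kappa_mul_shiftForm hd hΩo hua hvb).sqrt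
    rw [NonlocalGraph.localError, integral_congr_ae hae]
    refine hlim.congr' ?_
    filter_upwards [self_mem_nhdsWithin,
      nhdsWithin_le_nhds (lt_mem_nhds (show (0 : ℝ) < 1 / 2 by norm_num))] with s hs1 hs2
    rw [NonlocalGraph.nonlocalError, ← integral_const_mul]
    simp only [NonlocalGraph.scaling_mul_nonlocalErrorIntegrand]
    rw [NonlocalGraph.setIntegral_interactionSet_pairForm hd hs2 hs1 hm hua hvb]
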